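/- Let $K$ be a field and let $n\ge 1$. Let $Q_n$ be the cyclic quiver with vertices $i\in\mathbb Z/n$ and arrows $x_i\colon i\to i+1$. Let $y_1,\dots,y_r$ ($r\ge 1$) be distinct paths of length at least $1$ in $Q_n$, of the form $y=x_kx_{k+1}\cdots x_\ell$ (written left to right, indices modulo $n$, length not bounded by $n$), none of which is a subword of another. Let $\Lambda=KQ_n/I$ be the corresponding Nakayama algebra of order $n$, where $KQ_n$ is the path algebra and $I$ is the two-sided ideal generated by $y_1,\dots,y_r$. (If all relations have length at least $2$, this is a cyclic Nakayama algebra; if exactly one has length $1$, it is a linear one; if several have length $1$, it is a finite product of linear ones.) Say that a relation $y$ covers the vertex $i$ if $x_{i-1}x_i$ is a subword of $y$. Let the relation complex $L(\Lambda)$ be the finite simplicial complex with one vertex for every relation $y_j$ of length at most $n$, in which a nonempty set of such relations spans a simplex if and only if its members together do not cover all $n$ vertices of $Q_n$. Let $\chi(L(\Lambda))=\sum_{\sigma}(-1)^{\dim\sigma}$, where $\sigma$ runs over the simplices (so $\chi=0$ if the complex is empty). Then $\Lambda$ has finite global dimension, i.e. the projective dimensions of all right $\Lambda$-modules are bounded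 by a common natural number, if and only if $\chi(L(\Lambda))=1$. -/

import Mathlib

universe u

/-- A path in the cyclic quiver `Q_n`, whose vertices are the elements of `ZMod n` and whose arrows
are `x_i : i → i + 1`, one for every vertex `i`.  Every vertex is the source of exactly one arrow, so
a path is determined by its source `k` and its length `ℓ`: it is the word
`x_k x_{k+1} ⋯ x_{k+ℓ-1}`, written from left to right, with indices modulo `n`.
For `ℓ = 0` it is the trivial path `e_k`. -/
@[ext]
structure CyclePath (n : ℕ) where
  /-- the vertex at which the path starts -/
  source : ZMod n
  /-- the number of arrows of the path -/
  length : ℕ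

namespace CyclePath

variable {n : ℕ}

/-- The vertex at which a path ends. -/
def target (p : CyclePath n) : ZMod n := p.source + (p.length : ZMod n)

/-- `p` is a subword of `q`: the word `p` occurs in the word `q`, starting after the first `a`
letters of `q`, for some `a`. -/
def IsSubword (p q : CyclePath n) : Prop :=
  ∃ a : ℕ, p.source = q.source + (a : ZMod n) ∧ a + p.length ≤ q.length

/-- The path `p` covers the vertex `i`, i.e. `i` is an internal vertex of `p`: the word
`x_{i-1} x_i` is a subword of `p`. -/
def Covers (p : CyclePath n) (i : ZMod n) : Prop :=
  IsSubword ⟨i - 1, 2⟩ p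

/-- A path with at most `n` arrows does not cover its own source. -/
theorem not_covers_source {p : CyclePath n} (hp : p.length ≤ n) : ¬ p.Covers p.source := by
  rintro ⟨a, h, hl⟩
  have hl' : a + 2 ≤ p.length := hl
  have h1 : p.source - 1 = p.source + (a : ZMod n) := h
  have h0 : ((a + 1 : ℕ) : ZMod n) = 0 := by
    push_cast
    linear_combination -h1
  rw [ZMod.natCast_eq_zero_iff] at h0
  have := Nat.le_of_dvd (Nat.succ_pos a) h0
  omega

end CyclePath

/-- The path algebra `K Q_n` of the cyclic quiver: the `K`-vector space on all paths. -/
def CyclePathAlgebra (K : Type*) [Field K] (n : ℕ) : Type _ := CyclePath n →₀ K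

namespace CyclePathAlgebra

noncomputable section

variable (K : Type*) [Field K] (n : ℕ)

instance : AddCommGroup (CyclePathAlgebra K n) := inferInstanceAs (AddCommGroup (CyclePath n →₀ K))

instance : Module K (CyclePathAlgebra K n) := inferInstanceAs (Module K (CyclePath n →₀ K))

variable {n}

/-- A path, as an element of the path algebra. -/
def ofPath (p : CyclePath n) : CyclePathAlgebra K n := Finsupp.single p (1 : K)

/-- The basis of the path algebra that consists of all paths. -/
def basis : Module.Basis (CyclePath n) K (CyclePathAlgebra K n) :=
  Module.Basis.ofRepr (LinearEquiv.refl K (CyclePath n →₀ K))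

theorem basis_apply (p : CyclePath n) : basis K p = ofPath K p := rfl

open Classical in
/-- The product of two paths: `p q` is the path `p` followed by the path `q` if `q` starts where `p`
ends, and `0` otherwise. -/
def pathMul (p q : CyclePath n) : CyclePathAlgebra K n :=
  if p.target = q.source then ofPath K ⟨p.source, p.length + q.length⟩ else 0

/-- The multiplication of the path algebra: the bilinear extension of the product of paths. -/
def mulBilin : CyclePathAlgebra K n →ₗ[K] CyclePathAlgebra K n →ₗ[K] CyclePathAlgebra K n :=
  (basis K).constr K fun p => (basis K).constr K fun q => pathMul K p q

theorem mulBilin_ofPath (p q : CyclePath n) :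
    mulBilin K (ofPath K p) (ofPath K q) = pathMul K p q := by
  simp only [mulBilin, ← basis_apply, Module.Basis.constr_basis]

theorem induction_path {P : CyclePathAlgebra K n → Prop} (f : CyclePathAlgebra K n) (h0 : P 0)
    (hadd : ∀ f g, P f → P g → P (f + g)) (hpath : ∀ (c : K) (p : CyclePath n), P (c • ofPath K p)) :
    P f := by
  refine Finsupp.induction_linear (motive := P) f h0 hadd fun p c => ?_
  have h : c • ofPath K p = (Finsupp.single p c : CyclePath n →₀ K) := by
    refine (Finsupp.smul_single c p (1 : K)).trans ?_
    rw [smul_eq_mul, mul_one]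
  exact h ▸ hpath c p

theorem mulBilin_assoc (f g h : CyclePathAlgebra K n) :
    mulBilin K (mulBilin K f g) h = mulBilin K f (mulBilin K g h) := by
  induction f using induction_path with
  | h0 => simp
  | hadd f₁ f₂ h₁ h₂ => simp [h₁, h₂]
  | hpath c p =>
    induction g using induction_path with
    | h0 => simp
    | hadd g₁ g₂ h₁ h₂ => simp only [map_add, LinearMap.add_apply, h₁, h₂]
    | hpath d q =>
      induction h using induction_path with
      | h0 => simp
      | hadd k₁ k₂ h₁ h₂ => simp only [map_add, h₁, h₂]
      | hpath e r =>
        simp only [map_smul, LinearMap.smul_apply, mulBilin_ofPath]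
        congr 3
        unfold pathMul
        by_cases h₁ : p.target = q.source <;> by_cases h₂ : q.target = r.source
        · have h₃ : (⟨p.source, p.length + q.length⟩ : CyclePath n).target = r.source := by
            rw [← h₂, CyclePath.target, CyclePath.target, ← h₁, CyclePath.target]
            push_cast
            ring
          have h₄ : p.target = (⟨q.source, q.length + r.length⟩ : CyclePath n).source := h₁
          rw [if_pos h₁, if_pos h₂, mulBilin_ofPath, mulBilin_ofPath]
          unfold pathMul
          rw [if_pos h₃, if_pos h₄, add_assoc]
        · have h₃ : ¬ (⟨p.source, p.length + q.length⟩ : CyclePath n).target = r.source := by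
            intro h
            apply h₂
            rw [← h, CyclePath.target, CyclePath.target, ← h₁, CyclePath.target]
            push_cast
            ring
          rw [if_pos h₁, if_neg h₂, mulBilin_ofPath, map_zero]
          unfold pathMul
          rw [if_neg h₃]
        · have h₄ : ¬ p.target = (⟨q.source, q.length + r.length⟩ : CyclePath n).source := h₁
          rw [if_neg h₁, if_pos h₂, mulBilin_ofPath, map_zero, LinearMap.zero_apply]
          unfold pathMul
          rw [if_neg h₄]
        · rw [if_neg h₁, if_neg h₂, map_zero, map_zero, LinearMap.zero_apply]

variable [NeZero n]

/-- The identity of the path algebra: the sum of all trivial paths. -/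
def unit : CyclePathAlgebra K n := ∑ i : ZMod n, ofPath K ⟨i, 0⟩

theorem unit_mulBilin (f : CyclePathAlgebra K n) : mulBilin K (unit K) f = f := by
  induction f using induction_path with
  | h0 => simp
  | hadd f₁ f₂ h₁ h₂ => rw [map_add, h₁, h₂]
  | hpath c p =>
    rw [map_smul, unit, map_sum, LinearMap.sum_apply, Finset.sum_eq_single p.source]
    · rw [mulBilin_ofPath, pathMul, if_pos (by simp [CyclePath.target]), zero_add]
    · intro i _ hi
      rw [mulBilin_ofPath, pathMul, if_neg (by simpa [CyclePath.target] using hi)]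
    · simp

theorem mulBilin_unit (f : CyclePathAlgebra K n) : mulBilin K f (unit K) = f := by
  induction f using induction_path with
  | h0 => simp
  | hadd f₁ f₂ h₁ h₂ => rw [map_add, LinearMap.add_apply, h₁, h₂]
  | hpath c p =>
    rw [map_smul, LinearMap.smul_apply, unit, map_sum, Finset.sum_eq_single p.target]
    · rw [mulBilin_ofPath, pathMul, if_pos rfl, add_zero]
    · intro i _ hi
      rw [mulBilin_ofPath, pathMul, if_neg (Ne.symm hi)]
    · simp

instance : Ring (CyclePathAlgebra K n) :=
  { (inferInstance : AddCommGroup (CyclePathAlgebra K n)) with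
    mul := fun f g => mulBilin K f g
    one := unit K
    left_distrib := fun f g h => map_add (mulBilin K f) g h
    right_distrib := fun f g h => LinearMap.map_add₂ (mulBilin K) f g h
    zero_mul := fun f => LinearMap.map_zero₂ (mulBilin K) f
    mul_zero := fun f => map_zero (mulBilin K f)
    mul_assoc := mulBilin_assoc K
    one_mul := unit_mulBilin K
    mul_one := mulBilin_unit K }

theorem mul_def (f g : CyclePathAlgebra K n) : f * g = mulBilin K f g := rfl

theorem one_def : (1 : CyclePathAlgebra K n) = unit K := rfl

instance : Algebra K (CyclePathAlgebra K n) :=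
  Algebra.ofModule
    (fun c f g => LinearMap.map_smul₂ (mulBilin K) c f g)
    (fun c f g => map_smul (mulBilin K f) c g)

end

end CyclePathAlgebra

/-- The monomial relations that define a Nakayama algebra of order `n`: a finite nonempty set of
paths of length at least one in `Q_n`, none of which is a subword of another one.  (Relations of
length one are allowed; they delete arrows.) -/
structure NakayamaRelations (n : ℕ) where
  /-- the set of relations -/
  rels : Finset (CyclePath n)
  nonempty : rels.Nonempty
  one_le_length : ∀ y ∈ rels, 1 ≤ y.length
  irredundant : ∀ y ∈ rels, ∀ z ∈ rels, y.IsSubword z → y = z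

/-- The Nakayama algebra `Λ = K Q_n / I` of order `n`, where `I` is the two-sided ideal generated by
the relations. -/
abbrev NakayamaAlgebra (K : Type*) [Field K] {n : ℕ} [NeZero n] (Y : NakayamaRelations n) : Type _ :=
  (TwoSidedIdeal.span (CyclePathAlgebra.ofPath K '' (Y.rels : Set (CyclePath n)))).ringCon.Quotient

/-- `R` has finite (right) global dimension: the projective dimensions of all right `R`-modules,
i.e. of all modules over the opposite ring of `R`, are bounded by some natural number. -/
def HasFiniteGlobalDimension (R : Type u) [Ring R] : Prop :=
  ∃ d : ℕ, ∀ M : ModuleCat.{u} Rᵐᵒᵖ, CategoryTheory.HasProjectiveDimensionLE M d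

namespace NakayamaRelations

/-- The vertices of the relation complex: the relations of length at most `n`. -/
abbrev ShortRelation {n : ℕ} (Y : NakayamaRelations n) : Type :=
  {y : CyclePath n // y ∈ Y.rels ∧ y.length ≤ n}

noncomputable instance {n : ℕ} (Y : NakayamaRelations n) : Fintype Y.ShortRelation :=
  Fintype.ofInjective (fun y : Y.ShortRelation => (⟨y.1, y.2.1⟩ : {y // y ∈ Y.rels}))
    fun _ _ h => Subtype.ext (congrArg (fun z : {y // y ∈ Y.rels} => z.1) h)

/-- The relation complex `L(Λ)`: its vertices are the relations of length at most `n`, and a nonempty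
set of them spans a simplex if and only if its members do not cover all vertices of `Q_n`. -/
def relationComplex {n : ℕ} (Y : NakayamaRelations n) : AbstractSimplicialComplex Y.ShortRelation where
  faces := {s | s.Nonempty ∧ ¬ ∀ i : ZMod n, ∃ y ∈ s, y.1.Covers i}
  isRelLowerSet_faces := fun _ hs =>
    ⟨hs.1, fun _ hts ht =>
      ⟨ht, fun h => hs.2 fun i => (h i).imp fun _ hy => ⟨hts hy.1, hy.2⟩⟩⟩
  singleton_mem := fun v => by
    refine ⟨Finset.singleton_nonempty v, fun h => ?_⟩
    obtain ⟨y, hy, hc⟩ := h v.1.source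
    rw [Finset.mem_singleton] at hy
    subst hy
    exact CyclePath.not_covers_source y.2.2 hc

end NakayamaRelations

open Classical in
/-- The Euler characteristic of a finite simplicial complex: the number of simplices of even dimension
minus the number of simplices of odd dimension.  A simplex with `m` vertices has dimension `m - 1`. -/
noncomputable def AbstractSimplicialComplex.eulerCharacteristic {V : Type*} [Fintype V]
    (L : AbstractSimplicialComplex V) : ℤ :=
  ∑ s : Finset V with s ∈ L.faces, (-1 : ℤ) ^ (s.card - 1)

/-! Both sides are read off from one map on the universal cover `ℤ` of the cycle: `f = zeroEnd`
sends `i` to the end of the shortest zero path that starts at `i`. It is monotone, moves every point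
forward and commutes with translation by `n`. The link between the two sides is the number N of
`f`-orbits modulo `n` that close up after exactly one turn; each is counted by the one point `k` in
`[0, n)` with `orbitEntry f n k = k + n`.

Homological side. The right ideal generated by the path from `a` to `b` has as a syzygy the one
generated by the path from `b` to `f a`. Starting with the radical of an indecomposable projective,
the endpoints run through `i`, `i + 1`, `f i`, `f (i + 1)`, `f (f i)`, and so on. The projective
dimension is finite exactly when two consecutive terms coincide, that is, when the orbits of `i` and
`i + 1` merge with lag at most one (`hasFiniteGlobalDimension_iff`, `exists_iterate_syzygy_iff`).
The radicals control all modules, because a module has a finite filtration with semisimple layers,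
of length bounded independently of the module. Merging for all `i` is equivalent to N = 1
(`card_orbitEntry_eq_one_iff`): every orbit eventually enters a closed one if there is any, and
monotonicity bounds the lag.

Topological side. Relations are the arcs `[a, f a]` at the jumps `a` of `f`. The signed count of all
covering families of arcs is N - 1 (`sum_arcsCover`): sort the families by their least element,
cancel in pairs and telescope. Arcs at non-jumps do not affect this count (`sum_arcsCover_jumps`).
The signed count over all families of jumps is zero, so the non-covering ones contribute 1 - N; with
the empty family removed and the sign shifted this says that the Euler characteristic is N
(`eulerCharacteristic_relationComplex`). -/

/-! ### Lifts of circle maps and their orbits -/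

/-- `f` is the lift to `ℤ` of a monotone self-map of the circle `ℤ / n`, and it moves every point
forward. -/
structure IsForwardLift (n : ℕ) (f : ℤ → ℤ) : Prop where
  pos : 0 < n
  monotone : Monotone f
  lt_map : ∀ i, i < f i
  map_add : ∀ i, f (i + n) = f i + n

namespace IsForwardLift

variable {n : ℕ} {f : ℤ → ℤ}

theorem map_add_mul (hf : IsForwardLift n f) (i t : ℤ) : f (i + t * n) = f i + t * n := by
  induction t using Int.induction_on with
  | zero => simp
  | succ k ih =>
    have := hf.map_add (i + k * n)
    rw [ih] at this
    rw [add_mul, one_mul, ← add_assoc, this, add_assoc]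
  | pred k ih =>
    have := hf.map_add (i + (-k - 1) * n)
    rw [show i + (-(k : ℤ) - 1) * n + n = i + -k * n by ring, ih] at this
    linarith

theorem iterate_add_mul (hf : IsForwardLift n f) (k : ℕ) (i t : ℤ) :
    f^[k] (i + t * n) = f^[k] i + t * n := by
  induction k generalizing i with
  | zero => rfl
  | succ k ih => rw [Function.iterate_succ_apply, hf.map_add_mul, ih, Function.iterate_succ_apply]

theorem iterate_add (hf : IsForwardLift n f) (k : ℕ) (i : ℤ) : f^[k] (i + n) = f^[k] i + n := by
  simpa using hf.iterate_add_mul k i 1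

theorem strictMono_iterate (hf : IsForwardLift n f) (y : ℤ) : StrictMono fun k => f^[k] y :=
  strictMono_nat_of_lt_succ fun k => by
    rw [Function.iterate_succ_apply']
    exact hf.lt_map _

theorem add_le_iterate (hf : IsForwardLift n f) (y : ℤ) (k : ℕ) : y + k ≤ f^[k] y := by
  induction k with
  | zero => simp
  | succ k ih =>
    rw [Function.iterate_succ_apply']
    have := hf.lt_map (f^[k] y)
    push_cast
    omega

theorem exists_le_iterate (hf : IsForwardLift n f) (w y : ℤ) : ∃ k, w ≤ f^[k] y :=
  ⟨(w - y).toNat, by have := hf.add_le_iterate y (w - y).toNat; omega⟩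

end IsForwardLift

open Classical in
/-- The first element of the `f`-orbit of `y` that is at least `w`. -/
noncomputable def orbitEntry (f : ℤ → ℤ) (w y : ℤ) : ℤ :=
  -- The default `y` never occurs for a forward lift, by `exists_le_iterate`.
  if h : ∃ k, w ≤ f^[k] y then f^[Nat.find h] y else y

namespace IsForwardLift

variable {n : ℕ} {f : ℤ → ℤ}

theorem orbitEntry_eq {w y : ℤ} {k : ℕ} (hk : w ≤ f^[k] y) (hlt : ∀ j < k, f^[j] y < w) :
    orbitEntry f w y = f^[k] y := by
  have h : ∃ k, w ≤ f^[k] y := ⟨k, hk⟩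
  rw [orbitEntry, dif_pos h]
  congr 1
  rw [(Nat.find_eq_iff h).2 ⟨hk, fun j hj => not_le.2 (hlt j hj)⟩]

theorem exists_orbitEntry (hf : IsForwardLift n f) (w y : ℤ) :
    ∃ k, orbitEntry f w y = f^[k] y ∧ w ≤ f^[k] y ∧ ∀ j < k, f^[j] y < w := by
  classical
  have h := hf.exists_le_iterate w y
  exact ⟨Nat.find h, by rw [orbitEntry, dif_pos h], Nat.find_spec h,
    fun j hj => not_le.1 (Nat.find_min h hj)⟩

theorem le_orbitEntry (hf : IsForwardLift n f) (w y : ℤ) : w ≤ orbitEntry f w y := by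
  obtain ⟨k, h, hk, -⟩ := hf.exists_orbitEntry w y
  exact h ▸ hk

theorem orbitEntry_of_le {w y : ℤ} (h : w ≤ y) : orbitEntry f w y = y :=
  orbitEntry_eq (k := 0) h (by simp)

theorem orbitEntry_of_lt (hf : IsForwardLift n f) {w y : ℤ} (h : y < w) :
    orbitEntry f w y = orbitEntry f w (f y) := by
  obtain ⟨k, hk, hw, hlt⟩ := hf.exists_orbitEntry w (f y)
  rw [hk, ← Function.iterate_succ_apply]
  refine orbitEntry_eq hw fun j hj => ?_
  cases j with
  | zero => exact h
  | succ j => exact hlt j (by omega)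

theorem orbitEntry_iterate (hf : IsForwardLift n f) {w y : ℤ} {k : ℕ} (h : f^[k] y < w) :
    orbitEntry f w (f^[k] y) = orbitEntry f w y := by
  induction k with
  | zero => rfl
  | succ k ih =>
    have h' : f^[k] y < w := (hf.strictMono_iterate y (Nat.lt_succ_self k)).trans h
    rw [← ih h', Function.iterate_succ_apply', ← hf.orbitEntry_of_lt h']

theorem orbitEntry_le_iterate (hf : IsForwardLift n f) {w y : ℤ} {k : ℕ} (h : w ≤ f^[k] y) :
    orbitEntry f w y ≤ f^[k] y := by
  obtain ⟨l, hl, -, hlt⟩ := hf.exists_orbitEntry w y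
  rw [hl]
  refine (hf.strictMono_iterate y).monotone (not_lt.1 fun hkl => ?_)
  exact absurd (hlt k hkl) (not_lt.2 h)

end IsForwardLift

/-! ### Signed count of the covering families of arcs -/

/-- Every arc `[a, f a]` with `a ∈ S` ends after `w` or overlaps a later arc. -/
def Linked (f : ℤ → ℤ) (w : ℤ) (S : Finset ℤ) : Prop :=
  ∀ a ∈ S, w < f a ∨ ∃ b ∈ S, a < b ∧ b < f a

/-- Every integer lies in the interior of a translate, by a multiple of `n`, of an arc `[a, f a]` with
`a ∈ S`. -/
def ArcsCover (n : ℕ) (f : ℤ → ℤ) (S : Finset ℤ) : Prop :=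
  ∀ v : ℤ, ∃ a ∈ S, ∃ t : ℤ, a + t * n < v ∧ v < f a + t * n

/-- Since `y` lies below `T`, it is never the later arc for a member of `T`; only its own condition
is added. -/
theorem linked_insert {f : ℤ → ℤ} {w y m : ℤ} {T : Finset ℤ} (hT : T ⊆ Finset.Ico (y + 1) m) :
    Linked f w (insert y T) ↔ Linked f w T ∧ (w < f y ∨ ∃ b ∈ T, b < f y) := by
  have hy : ∀ b ∈ T, y < b := fun b hb => by
    have := Finset.mem_Ico.1 (hT hb)
    omega
  constructor
  · intro h
    refine ⟨fun a ha => (h a (Finset.mem_insert_of_mem ha)).imp_right ?_,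
      (h y (Finset.mem_insert_self _ _)).imp_right ?_⟩
    · rintro ⟨b, hb, hab, hba⟩
      rcases Finset.mem_insert.1 hb with rfl | hb
      · exact absurd (hy a ha) (by omega)
      · exact ⟨b, hb, hab, hba⟩
    · rintro ⟨b, hb, hab, hba⟩
      rcases Finset.mem_insert.1 hb with rfl | hb
      · exact absurd hab (lt_irrefl _)
      · exact ⟨b, hb, hba⟩
  · rintro ⟨h, h'⟩ a ha
    rcases Finset.mem_insert.1 ha with rfl | ha
    · exact h'.imp_right fun ⟨b, hb, hba⟩ => ⟨b, Finset.mem_insert_of_mem hb, hy b hb, hba⟩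
    · exact (h a ha).imp_right fun ⟨b, hb, hab⟩ => ⟨b, Finset.mem_insert_of_mem hb, hab⟩

theorem Ico_eq_insert {y m : ℤ} (h : y < m) : Finset.Ico y m = insert y (Finset.Ico (y + 1) m) := by
  ext a
  simp only [Finset.mem_Ico, Finset.mem_insert]
  omega

theorem sum_powerset_Ico {y m : ℤ} (h : y < m) (F : Finset ℤ → ℤ) :
    ∑ S ∈ (Finset.Ico y m).powerset, F S =
      ∑ S ∈ (Finset.Ico (y + 1) m).powerset, F S +
        ∑ S ∈ (Finset.Ico (y + 1) m).powerset, F (insert y S) := by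
  rw [Ico_eq_insert h, Finset.sum_powerset_insert (by simp)]

theorem card_insert_of_subset_Ico {y m : ℤ} {S : Finset ℤ}
    (hS : S ∈ (Finset.Ico (y + 1) m).powerset) : (insert y S).card = S.card + 1 := by
  refine Finset.card_insert_of_notMem fun hy => ?_
  have := Finset.mem_Ico.1 (Finset.mem_powerset.1 hS hy)
  omega

namespace IsForwardLift

variable {n : ℕ} {f : ℤ → ℤ}

-- The families `T` and `insert y T` cancel unless `f y ≤ w` and `T` has no member below `f y`. So
-- the sum for `y` equals the sum for `f y`, or vanishes if `f y` exceeds `w`. Following the orbit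
-- until it reaches `m` leaves only the empty family.
open Classical in
theorem sum_linked (hf : IsForwardLift n f) {m w : ℤ} (hw : m ≤ w) {y : ℤ} (hy : y ≤ w) :
    ∑ S ∈ (Finset.Ico y m).powerset, (if Linked f w S then (-1 : ℤ) ^ S.card else 0) =
      if orbitEntry f m y ≤ w then 1 else 0 := by
  induction hd : (m - y).toNat using Nat.strong_induction_on generalizing y with
  | _ d ih =>
  rcases le_or_gt m y with hmy | hmy
  · rw [Finset.Ico_eq_empty (by omega), orbitEntry_of_le hmy, if_pos hy]
    simp [Linked]
  · have key : ∀ S ∈ (Finset.Ico (y + 1) m).powerset,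
        (if Linked f w S then (-1 : ℤ) ^ S.card else 0) +
          (if Linked f w (insert y S) then (-1 : ℤ) ^ (insert y S).card else 0) =
        if ¬ w < f y ∧ ∀ b ∈ S, f y ≤ b then
          (if Linked f w S then (-1 : ℤ) ^ S.card else 0) else 0 := by
      intro S hS
      rw [card_insert_of_subset_Ico hS, linked_insert (Finset.mem_powerset.1 hS)]
      have h : (¬ w < f y ∧ ∀ b ∈ S, f y ≤ b) ↔ ¬ (w < f y ∨ ∃ b ∈ S, b < f y) := by
        push Not
        rfl
      simp only [h]
      by_cases h₁ : Linked f w S <;> by_cases h₂ : (w < f y ∨ ∃ b ∈ S, b < f y) <;>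
        simp [h₁, h₂, pow_succ]
    rw [sum_powerset_Ico hmy, ← Finset.sum_add_distrib, Finset.sum_congr rfl key,
      hf.orbitEntry_of_lt hmy]
    have hlt := hf.lt_map y
    by_cases hwy : w < f y
    · rw [orbitEntry_of_le (by omega), if_neg (by omega)]
      simp [hwy]
    · rw [← ih (m - f y).toNat (by omega) (by omega) rfl, ← Finset.sum_filter]
      refine Finset.sum_congr ?_ fun _ _ => rfl
      ext S
      simp only [Finset.mem_filter, Finset.mem_powerset, hwy, not_false_eq_true, true_and,
        Finset.subset_iff, Finset.mem_Ico]
      constructor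
      · exact fun h b hb => ⟨h.2 b hb, (h.1 hb).2⟩
      · exact fun h => ⟨fun b hb => ⟨by have := (h hb).1; omega, (h hb).2⟩, fun b hb => (h hb).1⟩

/-- Turns the cyclic covering condition into a linear one. An arc through `f a` must start after `a`
by monotonicity, and if `f a ≤ y + n`, it belongs to the same turn. Conversely, the last arc that
starts before `v` in its turn reaches past `v`. -/
theorem arcsCover_insert_iff (hf : IsForwardLift n f) {y : ℤ} (hy : 0 ≤ y) {T : Finset ℤ}
    (hT : T ⊆ Finset.Ico (y + 1) n) (hyn : y < n) :
    ArcsCover n f (insert y T) ↔ Linked f (y + n) (insert y T) := by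
  have hmem : ∀ a ∈ insert y T, y ≤ a ∧ a < n := by
    intro a ha
    rcases Finset.mem_insert.1 ha with rfl | ha
    · exact ⟨le_rfl, hyn⟩
    · have := Finset.mem_Ico.1 (hT ha)
      omega
  have hn : (0 : ℤ) < n := by exact_mod_cast hf.pos
  constructor
  · intro h a ha
    refine or_iff_not_imp_left.2 fun hw => ?_
    obtain ⟨b, hb, t, h₁, h₂⟩ := h (f a)
    rw [← hf.map_add_mul] at h₂
    have hab : a < b + t * n := hf.monotone.reflect_lt h₂
    have := hmem a ha
    have := hmem b hb
    have ht : t = 0 := by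
      have : t < 1 := by
        by_contra! hc
        nlinarith
      have : -1 < t := by
        by_contra! hc
        nlinarith
      omega
    subst ht
    exact ⟨b, hb, by omega, by omega⟩
  · intro h v
    set t := (v - y - 1) / n with ht
    have h₁ : t * n ≤ v - y - 1 := Int.ediv_mul_le _ hn.ne'
    have h₂ : v - y - 1 < (t + 1) * n := Int.lt_ediv_add_one_mul_self _ hn
    have hne : ((insert y T).filter fun a => a + t * n < v).Nonempty :=
      ⟨y, Finset.mem_filter.2 ⟨Finset.mem_insert_self _ _, by omega⟩⟩
    obtain ⟨ha, hav⟩ := Finset.mem_filter.1 (Finset.max'_mem _ hne)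
    set a := Finset.max' _ hne with ha_def
    refine ⟨a, ha, t, hav, ?_⟩
    rcases h a ha with hw | ⟨b, hb, hab, hba⟩
    · linarith
    · have : ¬ b + t * n < v := fun hc => by
        have hba : b ≤ a := Finset.le_max' _ b (Finset.mem_filter.2 ⟨hb, hc⟩)
        omega
      omega

open Classical in
/-- The signed number of sets of arcs that cover the circle. -/
theorem sum_arcsCover (hf : IsForwardLift n f) :
    ∑ S ∈ (Finset.Ico (0 : ℤ) n).powerset, (if ArcsCover n f S then (-1 : ℤ) ^ S.card else 0) =
      ((Finset.range n).filter fun k : ℕ => orbitEntry f n k = k + n).card - 1 := by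
  have hn : (0 : ℤ) < n := by exact_mod_cast hf.pos
  set C : ℕ → ℤ := fun k =>
    ∑ S ∈ (Finset.Ico (k : ℤ) n).powerset, (if ArcsCover n f S then (-1 : ℤ) ^ S.card else 0)
    with hC
  -- The families with least element `k` contribute the difference of two values of `sum_linked`,
  -- both for `w = k + n`. Splitting `≤` into `=` and `<` in the first, and reading `≤ k + n` as `<
  -- (k + 1) + n` in the second, makes everything but the counted points telescope.
  set q : ℕ → ℤ := fun k => if orbitEntry f n k < k + n then 1 else 0 with hq
  have step : ∀ k ∈ Finset.range n, C k - C (k + 1) =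
      (if orbitEntry f n k = k + n then 1 else 0) + (q k - q (k + 1)) := by
    intro k hk
    have hkn : (k : ℤ) < n := by exact_mod_cast Finset.mem_range.1 hk
    have h₁ := hf.sum_linked (m := n) (w := k + n) (by omega) (y := k) (by omega)
    have h₂ := hf.sum_linked (m := n) (w := k + n) (by omega) (y := k + 1) (by omega)
    rw [sum_powerset_Ico hkn] at h₁
    have h₃ : C k = C (k + 1) + ∑ S ∈ (Finset.Ico ((k : ℤ) + 1) n).powerset,
        (if Linked f (k + n) (insert (k : ℤ) S) then (-1 : ℤ) ^ (insert (k : ℤ) S).card else 0) := by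
      simp only [hC]
      rw [sum_powerset_Ico hkn]
      push_cast
      congr 1
      refine Finset.sum_congr rfl fun S hS => ?_
      rw [hf.arcsCover_insert_iff (by omega) (Finset.mem_powerset.1 hS) hkn]
    have h₄ : (if orbitEntry f n k ≤ k + n then (1 : ℤ) else 0) =
        (if orbitEntry f n k = k + n then 1 else 0) + q k := by
      simp only [hq]
      rcases lt_trichotomy (orbitEntry f n k) (k + n) with h | h | h
      · rw [if_pos h.le, if_neg h.ne, if_pos h, zero_add]
      · rw [if_pos h.le, if_pos h, if_neg h.not_lt, add_zero]
      · rw [if_neg (by omega), if_neg h.ne', if_neg (by omega), add_zero]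
    have h₅ : (if orbitEntry f n (k + 1) ≤ k + n then (1 : ℤ) else 0) = q (k + 1) := by
      simp only [hq]
      push_cast
      exact if_congr (by omega) rfl rfl
    linarith
  have h0 : q 0 = 0 := by
    have := hf.le_orbitEntry n 0
    simp only [hq]
    push_cast
    rw [if_neg (by omega)]
  have h1 : q n = 1 := by
    simp only [hq]
    rw [orbitEntry_of_le le_rfl, if_pos (by omega)]
  have h2 : C n = 0 := by
    simp [hC, ArcsCover]
  have h3 := Finset.sum_congr (rfl : Finset.range n = _) step
  rw [Finset.sum_range_sub', Finset.sum_add_distrib, Finset.sum_range_sub', h0, h1, h2,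
    Finset.sum_boole] at h3
  have h4 : C 0 = ∑ S ∈ (Finset.Ico (0 : ℤ) n).powerset,
      (if ArcsCover n f S then (-1 : ℤ) ^ S.card else 0) := by simp [hC]
  rw [← h4]
  linarith

/-! ### Restriction to the jumps -/

/-- Without a jump at or after `a` the map would be constant from there on, contrary to `f (a + n) =
f a + n`. -/
theorem exists_jump (hf : IsForwardLift n f) (a : ℤ) :
    ∃ k, a ≤ k ∧ f k = f a ∧ f k < f (k + 1) := by
  classical
  have hn : (0 : ℤ) < n := by exact_mod_cast hf.pos
  have hex : ∃ m : ℕ, f (a + m) < f (a + m + 1) := by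
    by_contra! hc
    have : ∀ m : ℕ, f (a + m) ≤ f a := by
      intro m
      induction m with
      | zero => simp
      | succ m ih =>
        have := hc m
        push_cast
        rw [← add_assoc]
        omega
    have := this n
    rw [hf.map_add] at this
    omega
  refine ⟨a + Nat.find hex, by omega, ?_, Nat.find_spec hex⟩
  have : ∀ m ≤ Nat.find hex, f (a + m) = f a := by
    intro m
    induction m with
    | zero => simp
    | succ m ih =>
      intro hm
      have h₁ := ih (by omega)
      have h₂ := Nat.find_min hex (m := m) (by omega)
      have h₃ := hf.monotone (show a + m ≤ a + m + 1 by omega)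
      push_cast
      rw [← add_assoc]
      omega
  exact this _ le_rfl

/-- The points of `[0, n)` at which the map `f` jumps. -/
noncomputable def _root_.jumps (n : ℕ) (f : ℤ → ℤ) : Finset ℤ :=
  (Finset.Ico (0 : ℤ) n).filter fun a => f a < f (a + 1)

theorem exists_mem_jumps (hf : IsForwardLift n f) (a : ℤ) :
    ∃ b ∈ jumps n f, ∃ t : ℤ, a ≤ b + t * n ∧ f b + t * n = f a := by
  have hn : (0 : ℤ) < n := by exact_mod_cast hf.pos
  obtain ⟨k, hak, hk, hlt⟩ := hf.exists_jump a
  have hd : k % n + k / n * n = k := Int.emod_add_ediv_mul k n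
  refine ⟨k % n, ?_, k / n, by omega, by rw [← hf.map_add_mul, hd, hk]⟩
  rw [jumps, Finset.mem_filter, Finset.mem_Ico]
  refine ⟨⟨Int.emod_nonneg _ hn.ne', Int.emod_lt_of_pos _ hn⟩, ?_⟩
  have h₁ := hf.map_add_mul (k % n) (k / n)
  have h₂ := hf.map_add_mul (k % n + 1) (k / n)
  rw [hd] at h₁
  rw [show k % n + 1 + k / n * n = k + 1 by omega] at h₂
  omega

/-- A translate of the arc of `b` is a final segment of the arc of `a`, so it adds no interior
point. -/
theorem arcsCover_insert_of_dominated {S : Finset ℤ} {a b t : ℤ}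
    (ha : a ∈ S) (hab : a ≤ b + t * n) (hfb : f b + t * n = f a) :
    ArcsCover n f (insert b S) ↔ ArcsCover n f S := by
  constructor
  · intro h v
    obtain ⟨c, hc, s, h₁, h₂⟩ := h v
    rcases Finset.mem_insert.1 hc with rfl | hc
    · refine ⟨a, ha, s - t, ?_, ?_⟩
      · linarith
      · linarith
    · exact ⟨c, hc, s, h₁, h₂⟩
  · intro h v
    obtain ⟨c, hc, s, h₁⟩ := h v
    exact ⟨c, Finset.mem_insert_of_mem hc, s, h₁⟩

-- A sign-reversing involution removes every family that contains a non-jump: take its least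
-- non-jump `a S` and toggle the jump `φ (a S)`, whose arc is dominated by that of `a S`. Toggling a
-- jump leaves `a S` unchanged.
open Classical in
theorem sum_arcsCover_jumps (hf : IsForwardLift n f) :
    ∑ S ∈ (jumps n f).powerset, (if ArcsCover n f S then (-1 : ℤ) ^ S.card else 0) =
      ∑ S ∈ (Finset.Ico (0 : ℤ) n).powerset, (if ArcsCover n f S then (-1 : ℤ) ^ S.card else 0) := by
  choose φ hφ hdom using hf.exists_mem_jumps
  have hsub : jumps n f ⊆ Finset.Ico (0 : ℤ) n := Finset.filter_subset _ _
  let a : Finset ℤ → ℤ := fun S =>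
    if h : (S \ jumps n f).Nonempty then (S \ jumps n f).min' h else 0
  let g : Finset ℤ → Finset ℤ := fun S => symmDiff S {φ (a S)}
  have hg : ∀ S, g S \ jumps n f = S \ jumps n f := by
    intro S
    ext b
    have := hφ (a S)
    simp only [g, Finset.mem_sdiff, Finset.mem_symmDiff, Finset.mem_singleton]
    by_cases hb : b = φ (a S)
    · subst hb
      simp [this]
    · simp [hb]
  have hag : ∀ S, a (g S) = a S := fun S => by simp only [a, hg]
  rw [← Finset.sum_sdiff (Finset.powerset_mono.2 hsub), right_eq_add]
  refine Finset.sum_involution (fun S _ => g S) ?_ ?_ ?_ ?_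
  · intro S hS
    rw [Finset.mem_sdiff, Finset.mem_powerset, Finset.mem_powerset, ← Finset.sdiff_nonempty] at hS
    have haS : a S ∈ S := by
      have := Finset.min'_mem _ hS.2
      simp only [a, dif_pos hS.2]
      exact (Finset.mem_sdiff.1 this).1
    have haJ : a S ∉ jumps n f := by
      have := Finset.min'_mem _ hS.2
      simp only [a, dif_pos hS.2]
      exact (Finset.mem_sdiff.1 this).2
    obtain ⟨t, h₁, h₂⟩ := hdom (a S)
    have hne : a S ≠ φ (a S) := fun h => haJ (h ▸ hφ (a S))
    by_cases hb : φ (a S) ∈ S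
    · have h₃ : g S = S.erase (φ (a S)) := by
        ext c
        simp only [g, Finset.mem_symmDiff, Finset.mem_singleton, Finset.mem_erase]
        constructor
        · rintro (h | h)
          · exact ⟨h.2, h.1⟩
          · exact absurd (h.1 ▸ hb) h.2
        · exact fun h => Or.inl ⟨h.2, h.1⟩
      have h₄ := arcsCover_insert_of_dominated (S := S.erase (φ (a S)))
        (Finset.mem_erase.2 ⟨hne, haS⟩) h₁ h₂
      rw [Finset.insert_erase hb] at h₄
      simp only [h₃, h₄, ← Finset.card_erase_add_one hb]
      split_ifs <;> simp [pow_succ]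
    · have h₃ : g S = insert (φ (a S)) S := by
        ext c
        simp only [g, Finset.mem_symmDiff, Finset.mem_singleton, Finset.mem_insert]
        constructor
        · rintro (h | h)
          · exact Or.inr h.1
          · exact Or.inl h.1
        · rintro (rfl | h)
          · exact Or.inr ⟨rfl, hb⟩
          · exact Or.inl ⟨h, fun hc => hb (hc ▸ h)⟩
      have h₄ := arcsCover_insert_of_dominated haS h₁ h₂
      simp only [h₃, h₄, Finset.card_insert_of_notMem hb]
      split_ifs <;> simp [pow_succ]
  · intro S _ _ h
    simp [g] at h
  · intro S hS
    rw [Finset.mem_sdiff, Finset.mem_powerset, Finset.mem_powerset] at hS ⊢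
    refine ⟨?_, ?_⟩
    · intro c hc
      rcases Finset.mem_symmDiff.1 hc with h | h
      · exact hS.1 h.1
      · rw [Finset.mem_singleton.1 h.1]
        exact hsub (hφ _)
    · rw [← Finset.sdiff_eq_empty_iff_subset, hg, Finset.sdiff_eq_empty_iff_subset]
      exact hS.2
  · intro S _
    change symmDiff (g S) {φ (a (g S))} = S
    rw [hag]
    exact symmDiff_symmDiff_cancel_right _ _

end IsForwardLift

namespace IsForwardLift

variable {n : ℕ} {f : ℤ → ℤ}

open Classical in
/-- The signed number of sets of irredundant arcs that do not cover the circle. -/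
theorem sum_not_arcsCover_jumps (hf : IsForwardLift n f) :
    ∑ S ∈ (jumps n f).powerset, (if ArcsCover n f S then 0 else (-1 : ℤ) ^ S.card) =
      1 - ((Finset.range n).filter fun k : ℕ => orbitEntry f n k = k + n).card := by
  have h₁ : (jumps n f).Nonempty := (hf.exists_mem_jumps 0).imp fun b hb => hb.1
  have h₂ := Finset.sum_powerset_neg_one_pow_card_of_nonempty h₁
  have h₃ : ∀ S : Finset ℤ, (-1 : ℤ) ^ S.card =
      (if ArcsCover n f S then 0 else (-1 : ℤ) ^ S.card) +
        (if ArcsCover n f S then (-1 : ℤ) ^ S.card else 0) := by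
    intro S
    split_ifs <;> simp
  rw [Finset.sum_congr rfl fun S _ => h₃ S, Finset.sum_add_distrib, hf.sum_arcsCover_jumps,
    hf.sum_arcsCover] at h₂
  linarith

/-! ### Orbits that wind once, and merging of orbits -/

/-- A point with `f^l x = x + n` has a translate of a point of its orbit that is the last point of
`[0, n)` in its own orbit. -/
theorem exists_orbitEntry_eq (hf : IsForwardLift n f) {x : ℤ} {l : ℕ} (h : f^[l] x = x + n) :
    ∃ k : ℕ, k < n ∧ orbitEntry f n k = k + n ∧ ∃ (m : ℕ) (t : ℤ), f^[m] x = k + t * n := by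
  have hn : (0 : ℤ) < n := by exact_mod_cast hf.pos
  have hd : x % n + x / n * n = x := Int.emod_add_ediv_mul x n
  have h0 : 0 ≤ x % n := Int.emod_nonneg _ hn.ne'
  have h1 : x % n < n := Int.emod_lt_of_pos _ hn
  set x₀ := x % n
  have hx₀ : f^[l] x₀ = x₀ + n := by
    have := hf.iterate_add_mul l x₀ (x / n)
    rw [hd, h] at this
    linarith
  have hle := hf.orbitEntry_le_iterate (w := n) (y := x₀) (k := l) (by omega)
  have hge := hf.le_orbitEntry n x₀
  obtain ⟨j, hj, -, hlt⟩ := hf.exists_orbitEntry n x₀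
  have hjl : j ≤ l := by
    by_contra! hc
    have := hlt l hc
    omega
  -- The first orbit point past `n`, moved back by one turn. It lies in `[0, x₀]` because `x₀ + n`
  -- is itself on the orbit, and its own orbit passes through `x₀`.
  set y := orbitEntry f n x₀ - n with hy
  have hcast : (y.toNat : ℤ) = y := Int.toNat_of_nonneg (by omega)
  have hyj : f^[j] x₀ = y + n := by omega
  have hyx : f^[l - j] y = x₀ := by
    have := hf.iterate_add (l - j) y
    rw [← hyj, ← Function.iterate_add_apply, Nat.sub_add_cancel hjl, hx₀] at this
    linarith
  refine ⟨y.toNat, by omega, ?_, j, x / n + 1, ?_⟩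
  · rw [hcast, ← hf.orbitEntry_iterate (k := l - j) (by omega), hyx]
    omega
  · have := hf.iterate_add_mul j x₀ (x / n)
    rw [hd, hyj] at this
    rw [hcast, this]
    ring

/-- The orbit of `y` is invariant under translation by `n`, so whole turns can be stripped off until
it passes through `z` itself; from there the two orbits enter `[n, ∞)` at the same point. -/
theorem orbitEntry_eq_of_iterate_eq (hf : IsForwardLift n f) {y z : ℤ}
    (hz : z < n) (hyn : orbitEntry f n y = y + n) {q M : ℕ} (h : f^[M] y = z + q * n)
    (hz0 : 0 ≤ z) : orbitEntry f n z = y + n := by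
  induction q generalizing M with
  | zero =>
    simp only [Nat.cast_zero, zero_mul, add_zero] at h
    rw [← h, hf.orbitEntry_iterate (by omega), hyn]
  | succ q ih =>
    obtain ⟨p, hp, -, hlt⟩ := hf.exists_orbitEntry n y
    have hpM : p ≤ M := by
      by_contra! hc
      have := hlt M hc
      push_cast at h
      nlinarith
    refine ih (M := M - p) ?_
    have := hf.iterate_add (M - p) y
    rw [← hyn, hp, ← Function.iterate_add_apply, Nat.sub_add_cancel hpM, h] at this
    push_cast at this
    linarith

theorem iterate_mul_eq (hf : IsForwardLift n f) {y : ℤ} {p : ℕ} (h : f^[p] y = y + n) (q : ℕ) :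
    f^[p * q] y = y + q * n := by
  induction q with
  | zero => simp
  | succ q ih =>
    rw [Nat.mul_succ, Nat.add_comm, Function.iterate_add_apply, ih, hf.iterate_add_mul, h]
    push_cast
    ring

/-- If neighbouring orbits merge, with lag at most one, then all orbits merge. -/
theorem exists_iterate_add_eq
    (h : ∀ i : ℤ, ∃ k, f^[k] i = f^[k] (i + 1) ∨ f^[k] (i + 1) = f^[k + 1] i) (i : ℤ) (d : ℕ) :
    ∃ k l, f^[k] (i + d) = f^[k + l] i := by
  induction d with
  | zero => exact ⟨0, 0, by simp⟩
  | succ d ih =>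
    obtain ⟨k, l, hkl⟩ := ih
    obtain ⟨m, hm⟩ := h (i + d)
    obtain ⟨e, he⟩ : ∃ e, f^[m] (i + d + 1) = f^[m + e] (i + d) := by
      rcases hm with hm | hm
      · exact ⟨0, hm.symm⟩
      · exact ⟨1, hm⟩
    refine ⟨k + m, e + l, ?_⟩
    push_cast
    rw [← add_assoc, Function.iterate_add_apply, he, ← Function.iterate_add_apply,
      show k + (m + e) = m + e + k by ring, Function.iterate_add_apply, hkl,
      ← Function.iterate_add_apply]
    congr 1
    ring

/-- The monotone map `F = f^[p] - n` fixes all translates of `y`, hence preserves the finite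
interval between two of them. Its orbits there are eventually periodic, and a periodic point of a
monotone map of a linear order is fixed. -/
theorem exists_iterate_eq_add (hf : IsForwardLift n f) {y : ℤ} {p : ℕ} (h : f^[p] y = y + n)
    (x : ℤ) : ∃ j, f^[p] (f^[j] x) = f^[j] x + n := by
  have hn : (0 : ℤ) < n := by exact_mod_cast hf.pos
  set F : ℤ → ℤ := fun z => f^[p] z - n with hF
  have hFm : Monotone F := fun a b hab => sub_le_sub_right (hf.monotone.iterate p hab) _
  have hFit : ∀ j z, F^[j] z = f^[p * j] z - j * n := by
    intro j
    induction j with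
    | zero => simp
    | succ j ih =>
      intro z
      rw [Function.iterate_succ_apply', ih, Nat.mul_succ, Nat.add_comm (p * j),
        Function.iterate_add_apply]
      have := hf.iterate_add_mul p (f^[p * j] z) (-j)
      simp only [hF, sub_eq_add_neg, ← neg_mul]
      rw [this]
      push_cast
      ring
  have hfix : ∀ t : ℤ, F (y + t * n) = y + t * n := by
    intro t
    simp only [hF, hf.iterate_add_mul, h]
    ring
  set t := (x - y) / n with ht
  have h₁ : t * n ≤ x - y := Int.ediv_mul_le _ hn.ne'
  have h₂ : x - y < (t + 1) * n := Int.lt_ediv_add_one_mul_self _ hn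
  have hmem : ∀ j, F^[j] x ∈ Set.Icc (y + t * n) (y + (t + 1) * n) := by
    intro j
    induction j with
    | zero => exact ⟨by simp; linarith, by simp; linarith⟩
    | succ j ih =>
      rw [Function.iterate_succ_apply']
      have h₃ := hFm ih.1
      have h₄ := hFm ih.2
      rw [hfix] at h₃ h₄
      exact ⟨h₃, h₄⟩
  obtain ⟨a, b, hab, he⟩ := Finite.exists_ne_map_eq_of_infinite
    fun j : ℕ => (⟨F^[j] x, hmem j⟩ : Set.Icc (y + t * n) (y + (t + 1) * n))
  have he' : F^[a] x = F^[b] x := congrArg Subtype.val he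
  wlog hlt : a < b generalizing a b
  · exact this b a hab.symm he.symm he'.symm (by omega)
  obtain ⟨m, rfl⟩ : ∃ m, b = m + 1 + a := ⟨b - a - 1, by omega⟩
  rw [Function.iterate_add_apply] at he'
  set z := F^[a] x with hz
  have hFz : F z = z := by
    refine le_antisymm ?_ ?_
    · by_contra! hc
      have := hFm.monotone_iterate_of_le_map hc.le (show 1 ≤ m + 1 by omega)
      simp only [Function.iterate_one] at this
      omega
    · by_contra! hc
      have := hFm.antitone_iterate_of_map_le hc.le (show 1 ≤ m + 1 by omega)
      simp only [Function.iterate_one] at this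
      omega
  refine ⟨p * a, ?_⟩
  have h₅ := hFit a x
  have h₆ : f^[p * a] x = z + a * n := by linarith
  rw [h₆, hf.iterate_add_mul]
  simp only [hF] at hFz
  linarith

/-- The number of orbits of `f` modulo `n` that wind once around the circle is one if and only if
neighbouring orbits merge, with lag at most one. -/
theorem card_orbitEntry_eq_one_iff (hf : IsForwardLift n f) :
    ((Finset.range n).filter fun k : ℕ => orbitEntry f n k = k + n).card = 1 ↔
      ∀ i : ℤ, ∃ k, f^[k] i = f^[k] (i + 1) ∨ f^[k] (i + 1) = f^[k + 1] i := by
  have hn : (0 : ℤ) < n := by exact_mod_cast hf.pos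
  rw [Finset.card_eq_one]
  constructor
  · rintro ⟨y, hy⟩ i
    have hyH : y < n ∧ orbitEntry f n y = y + n := by
      have : y ∈ ({y} : Finset ℕ) := Finset.mem_singleton_self y
      rwa [← hy, Finset.mem_filter, Finset.mem_range] at this
    obtain ⟨p, hp, -, -⟩ := hf.exists_orbitEntry n y
    rw [hyH.2] at hp
    have key : ∀ x : ℤ, ∃ (k : ℕ) (t : ℤ), f^[k] x = y + t * n := by
      intro x
      obtain ⟨j, hj⟩ := hf.exists_iterate_eq_add hp.symm x
      obtain ⟨k, hk, hkn, m, t, hm⟩ := hf.exists_orbitEntry_eq hj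
      have : k ∈ (Finset.range n).filter fun k : ℕ => orbitEntry f n k = k + n :=
        Finset.mem_filter.2 ⟨Finset.mem_range.2 hk, hkn⟩
      rw [hy, Finset.mem_singleton] at this
      exact ⟨m + j, t, by rw [Function.iterate_add_apply, hm, this]⟩
    obtain ⟨k, t, hk⟩ := key i
    obtain ⟨k', t', hk'⟩ := key (i + 1)
    -- A common translation `T` puts both orbits on the one forward orbit of `y`, since a turn is
    -- `p` further steps along it.
    obtain ⟨T, q, q', rfl, rfl⟩ : ∃ (T : ℤ) (q q' : ℕ), t = T + q ∧ t' = T + q' :=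
      ⟨min t t', (t - min t t').toNat, (t' - min t t').toNat, by omega, by omega⟩
    have hq := hf.iterate_mul_eq hp.symm q
    have hq' := hf.iterate_mul_eq hp.symm q'
    have e₁ : f^[k' + k] i = f^[k' + p * q] y + T * n := by
      rw [Function.iterate_add_apply, Function.iterate_add_apply, hk, hq, ← hf.iterate_add_mul]
      congr 1
      ring
    have e₂ : f^[k' + k] (i + 1) = f^[k + p * q'] y + T * n := by
      rw [Nat.add_comm k', Function.iterate_add_apply, Function.iterate_add_apply, hk', hq',
        ← hf.iterate_add_mul]
      congr 1
      ring
    have e₃ : f^[k' + k + 1] i = f^[k' + p * q + 1] y + T * n := by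
      rw [Function.iterate_succ_apply', e₁, hf.map_add_mul, Function.iterate_succ_apply']
    -- The sandwich `i ≤ i + 1 ≤ f i` survives iteration, and on a strictly increasing orbit it
    -- leaves only the lags zero and one.
    have hle := hf.monotone.iterate (k' + k) (show i ≤ i + 1 by omega)
    have hle' := hf.monotone.iterate (k' + k) (show i + 1 ≤ f i from hf.lt_map i)
    rw [← Function.iterate_succ_apply, e₂, e₃] at hle'
    rw [e₁, e₂] at hle
    have hsm := hf.strictMono_iterate (y : ℤ)
    have l₁ := hsm.le_iff_le.1 (show f^[k' + p * q] y ≤ f^[k + p * q'] y by omega)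
    have l₂ := hsm.le_iff_le.1 (show f^[k + p * q'] y ≤ f^[k' + p * q + 1] y by omega)
    refine ⟨k' + k, ?_⟩
    rw [e₁, e₂, e₃]
    rcases Nat.le_succ_iff.1 l₂ with l₂ | l₂
    · exact Or.inl (by rw [le_antisymm l₁ l₂])
    · exact Or.inr (by rw [l₂])
  · intro h
    -- Merging the orbits of `0` and `n` produces a point that returns to itself after one turn.
    obtain ⟨k, l, hkl⟩ := exists_iterate_add_eq h 0 n
    rw [hf.iterate_add, Nat.add_comm, Function.iterate_add_apply] at hkl
    obtain ⟨y, hyn, hy, -⟩ := hf.exists_orbitEntry_eq hkl.symm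
    refine ⟨y, Finset.eq_singleton_iff_unique_mem.2
      ⟨Finset.mem_filter.2 ⟨Finset.mem_range.2 hyn, hy⟩, ?_⟩⟩
    intro z hz
    obtain ⟨hzn, hz⟩ := Finset.mem_filter.1 hz
    rw [Finset.mem_range] at hzn
    have unique : ∀ a b : ℕ, a < n → b < n → orbitEntry f n a = a + n →
        orbitEntry f n b = b + n → a ≤ b → a = b := by
      intro a b ha hb hea heb hab
      obtain ⟨d, rfl⟩ := Nat.exists_eq_add_of_le hab
      obtain ⟨k, l, hkl⟩ := exists_iterate_add_eq h a d
      obtain ⟨p, hp, -, -⟩ := hf.exists_orbitEntry n ((a + d : ℕ) : ℤ)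
      rw [heb] at hp
      have hp0 : 1 ≤ p := by
        by_contra! hc
        rw [Nat.lt_one_iff.1 hc] at hp
        simp at hp
        omega
      -- After `k` turns the orbit of `a + d` is past the merging time and at a translate of `a +
      -- d`, so the orbit of `a` reaches that translate too.
      have hpk : k ≤ p * k := Nat.le_mul_of_pos_left k hp0
      have e := hf.iterate_mul_eq hp.symm k
      rw [← Nat.sub_add_cancel hpk, Function.iterate_add_apply] at e
      rw [show ((a + d : ℕ) : ℤ) = a + d by push_cast; rfl] at e
      rw [hkl, ← Function.iterate_add_apply] at e
      have := hf.orbitEntry_eq_of_iterate_eq (z := a + d)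
        (by exact_mod_cast hb) hea e (by omega)
      push_cast at heb
      omega
    rcases le_total y z with hle | hle
    · exact (unique y z hyn hzn hy hz hle).symm
    · exact unique z y hzn hyn hz hy hle

end IsForwardLift

/-! ### Projective dimension -/

open CategoryTheory in
theorem shortExact_ofHom {R : Type u} [Ring R] {M N P : Type u} [AddCommGroup M] [AddCommGroup N]
    [AddCommGroup P] [Module R M] [Module R N] [Module R P] {f : M →ₗ[R] N} {g : N →ₗ[R] P}
    (hf : Function.Injective f) (hfg : Function.Exact f g) (hg : Function.Surjective g) :
    (ShortComplex.mk (ModuleCat.ofHom f) (ModuleCat.ofHom g)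
      (ModuleCat.hom_ext (LinearMap.ext fun x => hfg.apply_apply_eq_zero x))).ShortExact :=
  ModuleCat.shortComplex_shortExact _ hfg hf hg

/-- `M` has projective dimension less than `d`. -/
abbrev Module.ProjectiveDimensionLT (R : Type u) [Ring R] (M : Type u) [AddCommGroup M] [Module R M]
    (d : ℕ) : Prop :=
  CategoryTheory.HasProjectiveDimensionLT (ModuleCat.of R M) d

namespace Module.ProjectiveDimensionLT

variable {R : Type u} [Ring R] {M N P : Type u} [AddCommGroup M] [AddCommGroup N]
  [AddCommGroup P] [Module R M] [Module R N] [Module R P] {f : M →ₗ[R] N} {g : N →ₗ[R] P}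

theorem mono {d e : ℕ} (h : ProjectiveDimensionLT R M d) (hde : d ≤ e) :
    ProjectiveDimensionLT R M e :=
  CategoryTheory.hasProjectiveDimensionLT_of_ge _ d e hde

theorem one_iff : ProjectiveDimensionLT R M 1 ↔ Module.Projective R M := by
  rw [IsProjective.iff_projective, CategoryTheory.projective_iff_hasProjectiveDimensionLT_one]

theorem of_linearEquiv {d : ℕ} (e : M ≃ₗ[R] N) (h : ProjectiveDimensionLT R M d) :
    ProjectiveDimensionLT R N d :=
  CategoryTheory.hasProjectiveDimensionLT_of_iso e.toModuleIso d

theorem of_subsingleton [Subsingleton M] (d : ℕ) : ProjectiveDimensionLT R M d :=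
  mono (ModuleCat.isZero_of_subsingleton (ModuleCat.of R M)).hasProjectiveDimensionLT_zero
    (Nat.zero_le d)

theorem extension (hf : Function.Injective f) (hfg : Function.Exact f g)
    (hg : Function.Surjective g) {d : ℕ} (hM : ProjectiveDimensionLT R M d)
    (hP : ProjectiveDimensionLT R P d) : ProjectiveDimensionLT R N d :=
  (shortExact_ofHom hf hfg hg).hasProjectiveDimensionLT_X₂ d hM hP

theorem succ_iff [Module.Projective R N] (hf : Function.Injective f) (hfg : Function.Exact f g)
    (hg : Function.Surjective g) {d : ℕ} :
    ProjectiveDimensionLT R P (d + 2) ↔ ProjectiveDimensionLT R M (d + 1) :=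
  (shortExact_ofHom hf hfg hg).hasProjectiveDimensionLT_X₃_iff d
    (inferInstanceAs (CategoryTheory.Projective (ModuleCat.of R N)))

/-- Dimension shifting along the direct sum of the free covers `M i →₀ R`. Infinite index types are
needed because modules are not assumed finitely generated. -/
theorem dfinsupp {ι : Type u} (M : ι → Type u) [∀ i, AddCommGroup (M i)] [∀ i, Module R (M i)]
    {d : ℕ} (h : ∀ i, ProjectiveDimensionLT R (M i) (d + 1)) :
    ProjectiveDimensionLT R (Π₀ i, M i) (d + 1) := by
  induction d generalizing M with
  | zero =>
    simp only [zero_add, one_iff] at h ⊢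
    infer_instance
  | succ d ih =>
    let g : ∀ i, (M i →₀ R) →ₗ[R] M i := fun i => Finsupp.linearCombination R id
    have hg : ∀ i, Function.Surjective (g i) := fun i => Finsupp.linearCombination_id_surjective R _
    have hk : ∀ i, ProjectiveDimensionLT R (LinearMap.ker (g i)) (d + 1) := fun i =>
      (succ_iff (Submodule.injective_subtype _) (LinearMap.exact_subtype_ker_map (g i))
        (hg i)).1 (h i)
    refine (succ_iff (N := Π₀ i, (M i →₀ R)) (f := DFinsupp.mapRange.linearMap fun i => (LinearMap.ker (g i)).subtype)
      (g := DFinsupp.mapRange.linearMap g) ?_ ?_ ?_).2 (ih _ hk)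
    · exact (DFinsupp.mapRange_injective _ fun _ => map_zero _).2 fun i =>
        Submodule.injective_subtype _
    · rw [LinearMap.exact_iff, DFinsupp.ker_mapRangeLinearMap, DFinsupp.range_mapRangeLinearMap]
      simp
    · exact (DFinsupp.mapRange_surjective _ fun _ => map_zero _).2 hg

end Module.ProjectiveDimensionLT

/-! ### Nonzero paths in the Nakayama algebra -/

/-- The projection of the path algebra onto the Nakayama algebra. -/
noncomputable abbrev NakayamaAlgebra.mk (K : Type*) [Field K] {n : ℕ} [NeZero n]
    (Y : NakayamaRelations n) : CyclePathAlgebra K n →ₐ[K] NakayamaAlgebra K Y :=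
  (TwoSidedIdeal.span (CyclePathAlgebra.ofPath K '' (Y.rels : Set (CyclePath n)))).ringCon.mkₐ K

namespace CyclePath

variable {n : ℕ}

theorem IsSubword.trans {p q r : CyclePath n} (h₁ : p.IsSubword q) (h₂ : q.IsSubword r) :
    p.IsSubword r := by
  obtain ⟨a, ha, ha'⟩ := h₁
  obtain ⟨b, hb, hb'⟩ := h₂
  exact ⟨b + a, by rw [ha, hb]; push_cast; ring, by omega⟩

end CyclePath

namespace CyclePathAlgebra

variable (K : Type*) [Field K] {n : ℕ}

/-- The coefficient of a path in an element of the path algebra. -/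
noncomputable def coeff (p : CyclePath n) : CyclePathAlgebra K n →ₗ[K] K := (basis K).coord p

open Classical in
theorem coeff_ofPath (p q : CyclePath n) : coeff K p (ofPath K q) = if q = p then 1 else 0 := by
  rw [coeff, ← basis_apply, Module.Basis.coord_apply, Module.Basis.repr_self,
    Finsupp.single_apply]

variable [NeZero n]

theorem ofPath_mul_ofPath_of_eq {p q : CyclePath n} (h : p.target = q.source) :
    ofPath K p * ofPath K q = ofPath K ⟨p.source, p.length + q.length⟩ := by
  rw [mul_def, mulBilin_ofPath, pathMul, if_pos h]

theorem ofPath_mul_ofPath_of_ne {p q : CyclePath n} (h : p.target ≠ q.source) :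
    ofPath K p * ofPath K q = 0 := by
  rw [mul_def, mulBilin_ofPath, pathMul, if_neg h]

theorem coeff_ofPath_mul (p : CyclePath n) (F : CyclePathAlgebra K n) :
    coeff K p (ofPath K p * F) = coeff K ⟨p.target, 0⟩ F := by
  classical
  induction F using induction_path with
  | h0 => simp
  | hadd f g hf hg => rw [mul_add, map_add, map_add, hf, hg]
  | hpath c q =>
    rw [mul_smul_comm, map_smul, map_smul]
    congr 1
    by_cases h : p.target = q.source
    · rw [ofPath_mul_ofPath_of_eq K h, coeff_ofPath, coeff_ofPath]
      refine if_congr ?_ rfl rfl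
      rw [CyclePath.ext_iff, CyclePath.ext_iff]
      simp [h]
    · rw [ofPath_mul_ofPath_of_ne K h, map_zero, coeff_ofPath, if_neg]
      rintro rfl
      exact h rfl

theorem coeff_mul_ofPath (p : CyclePath n) (F : CyclePathAlgebra K n) :
    coeff K p (F * ofPath K p) = coeff K ⟨p.source, 0⟩ F := by
  classical
  induction F using induction_path with
  | h0 => simp
  | hadd f g hf hg => rw [add_mul, map_add, map_add, hf, hg]
  | hpath c q =>
    rw [smul_mul_assoc, map_smul, map_smul]
    congr 1
    by_cases h : q.target = p.source
    · rw [ofPath_mul_ofPath_of_eq K h, coeff_ofPath, coeff_ofPath]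
      refine if_congr ?_ rfl rfl
      rw [CyclePath.ext_iff, CyclePath.ext_iff]
      simp
    · rw [ofPath_mul_ofPath_of_ne K h, map_zero, coeff_ofPath, if_neg]
      rintro rfl
      exact h (by simp [CyclePath.target])

end CyclePathAlgebra

namespace NakayamaRelations

variable {n : ℕ} (Y : NakayamaRelations n)

/-- A path is zero in the Nakayama algebra if it contains a relation. -/
def IsZeroPath (p : CyclePath n) : Prop := ∃ y ∈ Y.rels, y.IsSubword p

theorem exists_isZeroPath [NeZero n] (s : ZMod n) : ∃ l, Y.IsZeroPath ⟨s, l⟩ := by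
  obtain ⟨y, hy⟩ := Y.nonempty
  exact ⟨(y.source - s).val + y.length, y, hy, (y.source - s).val, by simp, le_rfl⟩

open Classical in
/-- The length of the shortest path from `s` that is zero, which is the composition length of the
indecomposable projective module at `s`. -/
noncomputable def loewyLength [NeZero n] (s : ZMod n) : ℕ := Nat.find (Y.exists_isZeroPath s)

variable {Y} in
theorem IsZeroPath.of_isSubword {p q : CyclePath n} (hp : Y.IsZeroPath p) (h : p.IsSubword q) :
    Y.IsZeroPath q :=
  hp.imp fun _ hy => ⟨hy.1, hy.2.trans h⟩

variable [NeZero n]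

theorem isZeroPath_iff {s : ZMod n} {l : ℕ} : Y.IsZeroPath ⟨s, l⟩ ↔ Y.loewyLength s ≤ l := by
  classical
  refine ⟨fun h => Nat.find_min' _ h, fun h => ?_⟩
  exact (Nat.find_spec (Y.exists_isZeroPath s)).of_isSubword ⟨0, by simp, (zero_add _).trans_le h⟩

theorem loewyLength_pos (s : ZMod n) : 0 < Y.loewyLength s := by
  rw [← not_le, Nat.le_zero, ← Nat.le_zero, ← isZeroPath_iff]
  rintro ⟨y, hy, a, -, h⟩
  have h₁ := Y.one_le_length y hy
  have h₂ : a + y.length ≤ 0 := h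
  omega

theorem loewyLength_le_succ (s : ZMod n) : Y.loewyLength s ≤ Y.loewyLength (s + 1) + 1 := by
  rw [← isZeroPath_iff]
  exact (Y.isZeroPath_iff.2 (le_refl (Y.loewyLength (s + 1)))).of_isSubword
    ⟨1, by simp, (add_comm _ _).le⟩

theorem loewyLength_le_add (s : ZMod n) (m : ℕ) :
    Y.loewyLength s ≤ Y.loewyLength (s + m) + m := by
  induction m with
  | zero => simp
  | succ m ih =>
    have := Y.loewyLength_le_succ (s + m)
    rw [show s + ((m + 1 : ℕ) : ZMod n) = s + m + 1 by push_cast; ring]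
    omega

end NakayamaRelations

namespace NakayamaAlgebra

open CyclePathAlgebra

variable (K : Type*) [Field K] {n : ℕ} [NeZero n] (Y : NakayamaRelations n)

theorem mk_surjective : Function.Surjective (mk K Y) := RingCon.mkₐ_surjective _

theorem mk_eq_zero_iff {F : CyclePathAlgebra K n} : mk K Y F = 0 ↔
    F ∈ TwoSidedIdeal.span (ofPath K '' (Y.rels : Set (CyclePath n))) := by
  rw [← map_zero (mk K Y), TwoSidedIdeal.mem_iff]
  exact RingCon.eq _

theorem mk_ofPath_eq_zero {p : CyclePath n} (hp : Y.IsZeroPath p) : mk K Y (ofPath K p) = 0 := by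
  obtain ⟨y, hy, a, ha, hl⟩ := hp
  have e : ofPath K p = ofPath K ⟨p.source, a⟩ * ofPath K y *
      ofPath K ⟨y.target, p.length - (a + y.length)⟩ := by
    rw [ofPath_mul_ofPath_of_eq K (p := ⟨p.source, a⟩) ha.symm, ofPath_mul_ofPath_of_eq]
    · congr 1
      ext
      · rfl
      · simp only
        omega
    · simp only [CyclePath.target]
      rw [ha]
      push_cast
      ring
  rw [mk_eq_zero_iff, e]
  exact TwoSidedIdeal.mul_mem_right _ _ _ (TwoSidedIdeal.mul_mem_left _ _ _
    (TwoSidedIdeal.subset_span ⟨y, hy, rfl⟩))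

/-- The span of the zero paths is a two-sided ideal containing the relations, hence contains `I`.
This makes the nonzero paths linearly independent in the quotient. -/
theorem coeff_eq_zero {F : CyclePathAlgebra K n} (hF : mk K Y F = 0) {p : CyclePath n}
    (hp : ¬ Y.IsZeroPath p) : coeff K p F = 0 := by
  classical
  set Z : Submodule K (CyclePathAlgebra K n) := Submodule.span K (ofPath K '' {q | Y.IsZeroPath q})
    with hZ
  have hleft : ∀ G H : CyclePathAlgebra K n, H ∈ Z → G * H ∈ Z := by
    intro G H hH
    induction hH using Submodule.span_induction with
    | zero => simp
    | add x y _ _ hx hy => rw [mul_add]; exact Z.add_mem hx hy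
    | smul c x _ hx => rw [mul_smul_comm]; exact Z.smul_mem _ hx
    | mem x hx =>
      obtain ⟨q, hq, rfl⟩ := hx
      induction G using induction_path with
      | h0 => simp
      | hadd f g hf hg => rw [add_mul]; exact Z.add_mem hf hg
      | hpath c r =>
        rw [smul_mul_assoc]
        refine Z.smul_mem _ ?_
        by_cases h : r.target = q.source
        · rw [ofPath_mul_ofPath_of_eq K h]
          exact Submodule.subset_span
            ⟨⟨r.source, r.length + q.length⟩, hq.of_isSubword ⟨r.length, h.symm, le_rfl⟩, rfl⟩
        · rw [ofPath_mul_ofPath_of_ne K h]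
          exact Z.zero_mem
  have hright : ∀ G H : CyclePathAlgebra K n, H ∈ Z → H * G ∈ Z := by
    intro G H hH
    induction hH using Submodule.span_induction with
    | zero => simp
    | add x y _ _ hx hy => rw [add_mul]; exact Z.add_mem hx hy
    | smul c x _ hx => rw [smul_mul_assoc]; exact Z.smul_mem _ hx
    | mem x hx =>
      obtain ⟨q, hq, rfl⟩ := hx
      induction G using induction_path with
      | h0 => simp
      | hadd f g hf hg => rw [mul_add]; exact Z.add_mem hf hg
      | hpath c r =>
        rw [mul_smul_comm]
        refine Z.smul_mem _ ?_
        by_cases h : q.target = r.source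
        · rw [ofPath_mul_ofPath_of_eq K h]
          exact Submodule.subset_span
            ⟨⟨q.source, q.length + r.length⟩, hq.of_isSubword ⟨0, by simp, by simp⟩, rfl⟩
        · rw [ofPath_mul_ofPath_of_ne K h]
          exact Z.zero_mem
  let I : TwoSidedIdeal (CyclePathAlgebra K n) := TwoSidedIdeal.mk' (Z : Set _) Z.zero_mem
    (fun hx hy => Z.add_mem hx hy) (fun hx => Z.neg_mem hx) (fun {x y} hy => hleft x y hy)
    (fun {x y} hx => hright y x hx)
  have hle : TwoSidedIdeal.span (ofPath K '' (Y.rels : Set (CyclePath n))) ≤ I := by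
    rw [TwoSidedIdeal.span_le]
    rintro _ ⟨y, hy, rfl⟩
    refine (TwoSidedIdeal.mem_mk' _ _ _ _ _ _ _).2 ?_
    exact Submodule.subset_span ⟨y, ⟨y, hy, 0, by simp, by simp⟩, rfl⟩
  have hFZ : F ∈ Z := by
    have := hle ((mk_eq_zero_iff K Y).1 hF)
    exact (TwoSidedIdeal.mem_mk' _ _ _ _ _ _ _).1 this
  clear hF
  induction hFZ using Submodule.span_induction with
  | zero => simp
  | add x y _ _ hx hy => rw [map_add, hx, hy, add_zero]
  | smul c x _ hx => rw [map_smul, hx, smul_zero]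
  | mem x hx =>
    obtain ⟨q, hq, rfl⟩ := hx
    rw [coeff_ofPath, if_neg]
    rintro rfl
    exact hp hq

/-- The residue class of a path in the Nakayama algebra. -/
noncomputable def path (s : ZMod n) (l : ℕ) : NakayamaAlgebra K Y := mk K Y (ofPath K ⟨s, l⟩)

theorem path_eq_zero {s : ZMod n} {l : ℕ} (h : Y.loewyLength s ≤ l) : path K Y s l = 0 :=
  mk_ofPath_eq_zero K Y (Y.isZeroPath_iff.2 h)

theorem path_mul_path (s : ZMod n) (l m : ℕ) :
    path K Y s l * path K Y (s + l) m = path K Y s (l + m) := by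
  rw [path, path, ← map_mul, ofPath_mul_ofPath_of_eq K rfl, path]

theorem path_mul_path_of_ne {s t : ZMod n} {l : ℕ} (h : s + l ≠ t) (m : ℕ) :
    path K Y s l * path K Y t m = 0 := by
  rw [path, path, ← map_mul, ofPath_mul_ofPath_of_ne K (p := ⟨s, l⟩) (q := ⟨t, m⟩) h, map_zero]

theorem vertex_mul_path (s : ZMod n) (l : ℕ) : path K Y s 0 * path K Y s l = path K Y s l := by
  simpa using path_mul_path K Y s 0 l

theorem path_mul_vertex (s : ZMod n) (l : ℕ) :
    path K Y s l * path K Y (s + l) 0 = path K Y s l := by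
  simpa using path_mul_path K Y s l 0

theorem sum_vertex : ∑ s : ZMod n, path K Y s 0 = 1 := by
  rw [← map_one (mk K Y), one_def, unit, map_sum]
  rfl

theorem induction_path {P : NakayamaAlgebra K Y → Prop} (x : NakayamaAlgebra K Y) (h0 : P 0)
    (hadd : ∀ x y, P x → P y → P (x + y)) (hpath : ∀ (c : K) (s : ZMod n) (l : ℕ),
      P (c • path K Y s l)) : P x := by
  obtain ⟨F, rfl⟩ := mk_surjective K Y x
  induction F using CyclePathAlgebra.induction_path with
  | h0 => simpa using h0
  | hadd f g hf hg => rw [map_add]; exact hadd _ _ hf hg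
  | hpath c p => rw [map_smul]; exact hpath c p.source p.length

/-- The expansion of an element of the projective right ideal at `s`, up to paths of length `r`. -/
theorem exists_expansion (s : ZMod n) (r : ℕ) (x : NakayamaAlgebra K Y) :
    ∃ (a : ℕ → K) (y : NakayamaAlgebra K Y), path K Y s 0 * x =
      ∑ l ∈ Finset.range r, a l • path K Y s l + path K Y s r * y := by
  classical
  induction x using induction_path with
  | h0 => exact ⟨0, 0, by simp⟩
  | hadd x y hx hy =>
    obtain ⟨a, x', hx⟩ := hx
    obtain ⟨b, y', hy⟩ := hy
    refine ⟨a + b, x' + y', ?_⟩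
    simp only [mul_add, hx, hy, Pi.add_apply, add_smul, Finset.sum_add_distrib]
    abel
  | hpath c t l =>
    by_cases hst : s = t
    · subst hst
      rw [mul_smul_comm, vertex_mul_path]
      by_cases hl : l < r
      · refine ⟨Pi.single l c, 0, ?_⟩
        rw [Finset.sum_eq_single l]
        · simp
        · intro b _ hb
          simp [hb]
        · simp [hl]
      · refine ⟨0, c • path K Y (s + r) (l - r), ?_⟩
        rw [mul_smul_comm, path_mul_path, Nat.add_sub_cancel' (not_lt.1 hl)]
        simp
    · refine ⟨0, 0, ?_⟩
      rw [mul_smul_comm, path_mul_path_of_ne K Y (by simpa using hst)]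
      simp

theorem coeff_eq_zero_of_sum {s : ZMod n} {m r : ℕ} {a : ℕ → K}
    (h : ∑ l ∈ Finset.range r, a l • path K Y s (m + l) = 0) {l : ℕ} (hl : l < r)
    (hlm : m + l < Y.loewyLength s) : a l = 0 := by
  classical
  have h' : mk K Y (∑ l ∈ Finset.range r, a l • ofPath K ⟨s, m + l⟩) = 0 := by
    rw [map_sum, ← h]
    exact Finset.sum_congr rfl fun l _ => map_smul _ _ _
  have := coeff_eq_zero K Y h' (p := ⟨s, m + l⟩) (by rw [Y.isZeroPath_iff]; omega)
  rw [map_sum, Finset.sum_eq_single l] at this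
  · simpa [coeff_ofPath] using this
  · intro b _ hb
    simp [coeff_ofPath, hb]
  · simp [hl]

/-- The coefficient of the trivial path at `s + m` in a lift of `x` would be one by `h₁`, but zero
if `x` killed a nonzero path from `s + m`. -/
theorem not_mul_eq {s : ZMod n} {m r : ℕ} (hm : m < Y.loewyLength s)
    (hr : r < Y.loewyLength (s + m)) {x : NakayamaAlgebra K Y}
    (h₁ : path K Y s m * x = path K Y s m) : x * path K Y (s + m) r ≠ 0 := by
  classical
  obtain ⟨F, rfl⟩ := mk_surjective K Y x
  intro h₂
  have h₃ := coeff_eq_zero K Y (F := ofPath K ⟨s, m⟩ * F - ofPath K ⟨s, m⟩)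
    (by rw [map_sub, map_mul]; exact sub_eq_zero.2 h₁) (p := ⟨s, m⟩)
    (by rw [Y.isZeroPath_iff]; omega)
  have h₄ := coeff_eq_zero K Y (F := F * ofPath K ⟨s + (m : ZMod n), r⟩) (by rw [map_mul]; exact h₂)
    (p := ⟨s + (m : ZMod n), r⟩) (by rw [Y.isZeroPath_iff]; omega)
  rw [coeff_mul_ofPath] at h₄
  rw [map_sub, coeff_ofPath_mul, coeff_ofPath, if_pos rfl] at h₃
  have h₅ : coeff K ⟨s + (m : ZMod n), 0⟩ F = 0 := h₄
  have h₆ : coeff K ⟨s + (m : ZMod n), 0⟩ F - 1 = 0 := h₃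
  rw [h₅] at h₆
  simp at h₆

end NakayamaAlgebra

/-! ### Right ideals generated by paths, and their syzygies -/

open Module (ProjectiveDimensionLT)

namespace NakayamaAlgebra

variable (K : Type u) [Field K] {n : ℕ} [NeZero n] (Y : NakayamaRelations n)

local notation "Λ" => NakayamaAlgebra K Y

/-- The right ideal of the Nakayama algebra that is generated by a path. -/
noncomputable def pathIdeal (s : ZMod n) (l : ℕ) : Submodule Λᵐᵒᵖ Λ :=
  Submodule.span Λᵐᵒᵖ {path K Y s l}

theorem mem_pathIdeal {s : ZMod n} {l : ℕ} {x : Λ} :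
    x ∈ pathIdeal K Y s l ↔ ∃ y, path K Y s l * y = x := by
  rw [pathIdeal, Submodule.mem_span_singleton]
  exact ⟨fun ⟨a, ha⟩ => ⟨a.unop, ha⟩, fun ⟨y, hy⟩ => ⟨MulOpposite.op y, hy⟩⟩

theorem path_mem_pathIdeal (s : ZMod n) (l : ℕ) : path K Y s l ∈ pathIdeal K Y s l :=
  Submodule.mem_span_singleton_self _

theorem vertex_mul_of_mem {s : ZMod n} {l : ℕ} {x : Λ} (hx : x ∈ pathIdeal K Y s l) :
    path K Y s 0 * x = x := by
  obtain ⟨y, rfl⟩ := (mem_pathIdeal K Y).1 hx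
  rw [← mul_assoc, vertex_mul_path]

theorem pathIdeal_le (s : ZMod n) (l : ℕ) : pathIdeal K Y s l ≤ pathIdeal K Y s 0 := fun _ hx =>
  (mem_pathIdeal K Y).2 ⟨_, vertex_mul_of_mem K Y hx⟩

theorem sum_vertex_smul {M : Type u} [AddCommGroup M] [Module Λᵐᵒᵖ M] (m : M) :
    ∑ s : ZMod n, MulOpposite.op (path K Y s 0) • m = m := by
  rw [← Finset.sum_smul, ← Finset.op_sum, sum_vertex, MulOpposite.op_one, one_smul]

/-- The homomorphism from the projective right ideal at `s` that is given by an element `m` of a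
right module with `m e_s = m`. -/
noncomputable def homOfElement {M : Type u} [AddCommGroup M] [Module Λᵐᵒᵖ M] (s : ZMod n) (m : M) :
    pathIdeal K Y s 0 →ₗ[Λᵐᵒᵖ] M where
  toFun x := MulOpposite.op (x : Λ) • m
  map_add' x y := by rw [Submodule.coe_add, MulOpposite.op_add, add_smul]
  map_smul' a x := by
    rw [RingHom.id_apply, ← mul_smul]
    rfl

instance projective_pathIdeal_zero (s : ZMod n) :
    Module.Projective Λᵐᵒᵖ (pathIdeal K Y s 0) := by
  refine Module.Projective.of_lifting_property'' fun f hf => ?_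
  obtain ⟨m, hm⟩ := hf ⟨path K Y s 0, path_mem_pathIdeal K Y s 0⟩
  refine ⟨homOfElement K Y s m, LinearMap.ext fun x => Subtype.ext ?_⟩
  change ((f (MulOpposite.op (x : Λ) • m) : pathIdeal K Y s 0) : Λ) = x
  rw [map_smul, hm]
  exact vertex_mul_of_mem K Y x.2

/-- Left multiplication with a path. -/
noncomputable def mulPath (s : ZMod n) (l : ℕ) :
    pathIdeal K Y (s + l) 0 →ₗ[Λᵐᵒᵖ] pathIdeal K Y s l where
  toFun x := ⟨path K Y s l * (x : Λ), (mem_pathIdeal K Y).2 ⟨_, rfl⟩⟩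
  map_add' _ _ := Subtype.ext (mul_add _ _ _)
  map_smul' _ _ := Subtype.ext (mul_assoc _ _ _).symm

theorem mulPath_surjective (s : ZMod n) (l : ℕ) : Function.Surjective (mulPath K Y s l) := by
  rintro ⟨x, hx⟩
  obtain ⟨y, rfl⟩ := (mem_pathIdeal K Y).1 hx
  refine ⟨⟨path K Y (s + l) 0 * y, (mem_pathIdeal K Y).2 ⟨_, rfl⟩⟩, Subtype.ext ?_⟩
  change path K Y s l * (path K Y (s + l) 0 * y) = _
  rw [← mul_assoc, path_mul_vertex]

/-- Expand a kernel element in paths from `s + l`. Left multiplication sends those shorter than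
`Y.loewyLength s - l` to distinct nonzero paths, so their coefficients vanish; the longer ones lie
in the claimed ideal. -/
theorem exact_mulPath {s : ZMod n} {l : ℕ} (hl : l ≤ Y.loewyLength s) :
    Function.Exact (Submodule.inclusion (pathIdeal_le K Y (s + l) (Y.loewyLength s - l)))
      (mulPath K Y s l) := by
  rintro ⟨x, hx⟩
  constructor
  · intro h
    have h₀ : path K Y s l * x = 0 := congrArg Subtype.val h
    obtain ⟨a, y, hy⟩ := exists_expansion K Y (s + l) (Y.loewyLength s - l) x
    rw [vertex_mul_of_mem K Y hx] at hy
    have h₁ : ∑ i ∈ Finset.range (Y.loewyLength s - l), a i • path K Y s (l + i) = 0 := by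
      rw [hy, mul_add, ← mul_assoc, path_mul_path, path_eq_zero K Y (l := l + _) (by omega),
        zero_mul, add_zero, Finset.mul_sum] at h₀
      rw [← h₀]
      refine Finset.sum_congr rfl fun i _ => ?_
      rw [mul_smul_comm, path_mul_path]
    have h₂ : x = path K Y (s + l) (Y.loewyLength s - l) * y := by
      rw [hy, Finset.sum_eq_zero, zero_add]
      intro i hi
      have := Finset.mem_range.1 hi
      rw [coeff_eq_zero_of_sum K Y h₁ this (by omega), zero_smul]
    exact ⟨⟨x, (mem_pathIdeal K Y).2 ⟨y, h₂.symm⟩⟩, rfl⟩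
  · rintro ⟨⟨z, hz⟩, h⟩
    obtain ⟨y, rfl⟩ := (mem_pathIdeal K Y).1 hz
    have h' : path K Y (s + l) (Y.loewyLength s - l) * y = x := congrArg Subtype.val h
    refine Subtype.ext ?_
    change path K Y s l * x = 0
    rw [← h', ← mul_assoc, path_mul_path, path_eq_zero K Y (by omega), zero_mul]

/-- The right ideal `p Λ` has the right ideal `q Λ` as a syzygy, where `p q` is the shortest zero path
that begins with `p`. -/
theorem projectiveDimensionLT_pathIdeal_iff {s : ZMod n} {l : ℕ} (hl : l ≤ Y.loewyLength s)
    {d : ℕ} : ProjectiveDimensionLT Λᵐᵒᵖ (pathIdeal K Y s l) (d + 2) ↔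
      ProjectiveDimensionLT Λᵐᵒᵖ (pathIdeal K Y (s + l) (Y.loewyLength s - l)) (d + 1) :=
  ProjectiveDimensionLT.succ_iff (Submodule.inclusion_injective _) (exact_mulPath K Y hl)
    (mulPath_surjective K Y s l)

/-- A splitting of `mulPath` would send the generator to an `x` that is excluded by `not_mul_eq`. -/
theorem not_projective_pathIdeal {s : ZMod n} {l : ℕ} (hl : l < Y.loewyLength s)
    (hl' : Y.loewyLength s - l < Y.loewyLength (s + l)) :
    ¬ Module.Projective Λᵐᵒᵖ (pathIdeal K Y s l) := by
  intro h
  obtain ⟨σ, hσ⟩ := Module.projective_lifting_property (mulPath K Y s l) LinearMap.id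
    (mulPath_surjective K Y s l)
  set p : pathIdeal K Y s l := ⟨path K Y s l, path_mem_pathIdeal K Y s l⟩
  set r := Y.loewyLength s - l with hr
  have h₁ : path K Y s l * (σ p : Λ) = path K Y s l :=
    congrArg Subtype.val (LinearMap.congr_fun hσ p)
  refine not_mul_eq K Y hl hl' h₁ ?_
  have h₂ : MulOpposite.op (path K Y (s + l) r) • p = 0 := by
    refine Subtype.ext ?_
    change path K Y s l * path K Y (s + l) r = 0
    rw [path_mul_path, path_eq_zero K Y (by omega)]
  have h₃ := map_smul σ (MulOpposite.op (path K Y (s + l) r)) p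
  rw [h₂, map_zero] at h₃
  exact (congrArg Subtype.val h₃).symm

/-! ### From the radicals of the projectives to all modules -/

/-- A simple right module on which the arrows act as zero is the top of the projective right ideal at
some vertex. -/
theorem projectiveDimensionLT_of_isSimpleModule {d : ℕ}
    (hd : ∀ s, ProjectiveDimensionLT Λᵐᵒᵖ (pathIdeal K Y s 1) (d + 1))
    {M : Type u} [AddCommGroup M] [Module Λᵐᵒᵖ M] [IsSimpleModule Λᵐᵒᵖ M]
    (hM : ∀ (s : ZMod n) (m : M), MulOpposite.op (path K Y s 1) • m = 0) :
    ProjectiveDimensionLT Λᵐᵒᵖ M (d + 2) := by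
  have := IsSimpleModule.nontrivial Λᵐᵒᵖ M
  obtain ⟨m₀, hm₀⟩ := exists_ne (0 : M)
  obtain ⟨s, hs⟩ : ∃ s, MulOpposite.op (path K Y s 0) • m₀ ≠ 0 := by
    by_contra! hc
    refine hm₀ ?_
    rw [← sum_vertex_smul K Y m₀]
    exact Finset.sum_eq_zero fun s _ => hc s
  set m := MulOpposite.op (path K Y s 0) • m₀ with hm
  refine (ProjectiveDimensionLT.succ_iff (f := Submodule.inclusion (pathIdeal_le K Y s 1))
    (g := homOfElement K Y s m) (Submodule.inclusion_injective _) ?_ ?_).2 (hd s)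
  · rintro ⟨x, hx⟩
    constructor
    · intro h
      have h₀ : MulOpposite.op x • m = 0 := h
      obtain ⟨a, y, hy⟩ := exists_expansion K Y s 1 x
      rw [vertex_mul_of_mem K Y hx, Finset.sum_range_one] at hy
      have ha : a 0 = 0 := by
        by_contra ha
        refine hs ?_
        have h₁ : MulOpposite.op (a 0 • path K Y s 0) • m = 0 := by
          rw [hy, MulOpposite.op_add, add_smul, MulOpposite.op_mul, mul_smul, hM, smul_zero,
            add_zero] at h₀
          exact h₀
        -- `M` carries no separate action of `K`; scalars act through multiples of the vertex
        -- idempotent, so division by `a 0` happens inside the algebra.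
        have h₂ : path K Y s 0 * (a 0 • path K Y s 0) * ((a 0)⁻¹ • path K Y s 0) =
            path K Y s 0 := by
          rw [mul_smul_comm, mul_smul_comm, smul_mul_assoc, smul_smul, inv_mul_cancel₀ ha, one_smul,
            vertex_mul_path, vertex_mul_path]
        rw [hm, ← mul_smul, ← MulOpposite.op_mul] at h₁
        rw [hm, ← h₂, MulOpposite.op_mul, mul_smul, h₁, smul_zero]
      rw [ha, zero_smul, zero_add] at hy
      exact ⟨⟨x, (mem_pathIdeal K Y).2 ⟨y, hy.symm⟩⟩, rfl⟩
    · rintro ⟨⟨z, hz⟩, h⟩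
      obtain ⟨y, rfl⟩ := (mem_pathIdeal K Y).1 hz
      have h' : path K Y s 1 * y = x := congrArg Subtype.val h
      change MulOpposite.op x • m = 0
      rw [← h', MulOpposite.op_mul, mul_smul, hM, smul_zero]
  · refine LinearMap.surjective_of_ne_zero fun h => hs ?_
    have := LinearMap.congr_fun h ⟨path K Y s 0, path_mem_pathIdeal K Y s 0⟩
    change MulOpposite.op (path K Y s 0) • m = 0 at this
    rwa [hm, ← mul_smul, ← MulOpposite.op_mul, vertex_mul_path] at this

/-- A right module on which the arrows act as zero is semisimple. -/
theorem isSemisimpleModule_of_arrows {M : Type u} [AddCommGroup M] [Module Λᵐᵒᵖ M]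
    (hM : ∀ (s : ZMod n) (m : M), MulOpposite.op (path K Y s 1) • m = 0) :
    IsSemisimpleModule Λᵐᵒᵖ M := by
  refine isSemisimpleModule_of_isSemisimpleModule_submodule'
    (ι := {m : M // m ≠ 0 ∧ ∃ s, MulOpposite.op (path K Y s 0) • m = m})
    (p := fun m => Submodule.span Λᵐᵒᵖ {m.1}) ?_ ?_
  · rintro ⟨m, hm, s, hs⟩
    have : IsSimpleModule Λᵐᵒᵖ (Submodule.span Λᵐᵒᵖ {m}) := by
      rw [isSimpleModule_iff_isAtom]
      refine ⟨by simpa using hm, fun N hN => ?_⟩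
      by_contra hN0
      obtain ⟨v, hv, hv0⟩ := (Submodule.ne_bot_iff N).1 hN0
      obtain ⟨b, rfl⟩ := Submodule.mem_span_singleton.1 (hN.le hv)
      obtain ⟨a, y, hy⟩ := exists_expansion K Y s 1 b.unop
      have hb : b • m = MulOpposite.op (a 0 • path K Y s 0) • m := by
        nth_rw 1 [← hs]
        rw [← mul_smul, ← MulOpposite.op_unop b, ← MulOpposite.op_mul, hy, Finset.sum_range_one,
          MulOpposite.op_add, add_smul, MulOpposite.op_mul, mul_smul, hM, smul_zero, add_zero]
      have ha : a 0 ≠ 0 := by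
        intro ha
        rw [hb, ha, zero_smul, MulOpposite.op_zero, zero_smul] at hv0
        exact hv0 rfl
      refine hN.not_ge ((Submodule.span_singleton_le_iff_mem _ _).2 ?_)
      have hmb : MulOpposite.op ((a 0)⁻¹ • path K Y s 0) • b • m = m := by
        rw [hb, ← mul_smul, ← MulOpposite.op_mul, mul_smul_comm, smul_mul_assoc, smul_smul,
          inv_mul_cancel₀ ha, one_smul, vertex_mul_path, hs]
      rw [← hmb]
      exact N.smul_mem _ hv
    infer_instance
  · rw [eq_top_iff]
    rintro m -
    rw [← sum_vertex_smul K Y m]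
    refine Submodule.sum_mem _ fun s _ => ?_
    by_cases h0 : MulOpposite.op (path K Y s 0) • m = 0
    · rw [h0]
      exact Submodule.zero_mem _
    · refine Submodule.mem_iSup_of_mem ⟨_, h0, s, ?_⟩ (Submodule.mem_span_singleton_self _)
      rw [← mul_smul, ← MulOpposite.op_mul, vertex_mul_path]

theorem projectiveDimensionLT_of_arrows {d : ℕ}
    (hd : ∀ s, ProjectiveDimensionLT Λᵐᵒᵖ (pathIdeal K Y s 1) (d + 1))
    {M : Type u} [AddCommGroup M] [Module Λᵐᵒᵖ M]
    (hM : ∀ (s : ZMod n) (m : M), MulOpposite.op (path K Y s 1) • m = 0) :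
    ProjectiveDimensionLT Λᵐᵒᵖ M (d + 2) := by
  have := isSemisimpleModule_of_arrows K Y hM
  obtain ⟨S, e, -, hS⟩ := IsSemisimpleModule.exists_linearEquiv_dfinsupp Λᵐᵒᵖ M
  refine .of_linearEquiv e.symm (.dfinsupp _ fun N => ?_)
  have := hS N
  exact projectiveDimensionLT_of_isSimpleModule K Y hd fun s m => Subtype.ext (hM s m)

/-- The submodule of all elements that are annihilated by all arrows. -/
def arrowSocle (M : Type u) [AddCommGroup M] [Module Λᵐᵒᵖ M] : Submodule Λᵐᵒᵖ M where
  carrier := {m | ∀ (s : ZMod n) (l : ℕ), MulOpposite.op (path K Y s (l + 1)) • m = 0}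
  zero_mem' s l := smul_zero _
  add_mem' ha hb s l := by rw [smul_add, ha, hb, add_zero]
  smul_mem' a m hm s l := by
    rw [← mul_smul, ← MulOpposite.op_unop a, ← MulOpposite.op_mul]
    generalize a.unop = x
    induction x using induction_path with
    | h0 => simp
    | hadd x y hx hy => rw [add_mul, MulOpposite.op_add, add_smul, hx, hy, add_zero]
    | hpath c t k =>
      rw [smul_mul_assoc]
      have : MulOpposite.op (c • (path K Y t k * path K Y s (l + 1))) • m = 0 := by
        by_cases h : t + k = s
        · subst h
          rw [path_mul_path, ← vertex_mul_path, ← smul_mul_assoc]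
          -- The scalar is moved to the right end of the path, so that in the opposite action the
          -- path of positive length meets `m` first.
          have h₁ : (c • path K Y t 0) * path K Y t (k + (l + 1)) =
              path K Y t (k + l + 1) * (c • path K Y (t + (k + l + 1 : ℕ)) 0) := by
            rw [smul_mul_assoc, mul_smul_comm, vertex_mul_path, path_mul_vertex, add_assoc]
          rw [h₁, MulOpposite.op_mul, mul_smul, hm, smul_zero]
        · rw [path_mul_path_of_ne K Y h]
          simp
      exact this

/-- Dividing by the arrow socle lowers by one the length from which all paths act as zero.
Extensions do not increase a common bound, so the bound is independent of `t`. -/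
theorem projectiveDimensionLT_of_paths {d : ℕ}
    (hd : ∀ s, ProjectiveDimensionLT Λᵐᵒᵖ (pathIdeal K Y s 1) (d + 1)) (t : ℕ)
    {M : Type u} [AddCommGroup M] [Module Λᵐᵒᵖ M]
    (hM : ∀ (s : ZMod n) (l : ℕ), t ≤ l → ∀ m : M, MulOpposite.op (path K Y s l) • m = 0) :
    ProjectiveDimensionLT Λᵐᵒᵖ M (d + 2) := by
  induction t generalizing M with
  | zero =>
    have : Subsingleton M := subsingleton_of_forall_eq 0 fun m => by
      rw [← sum_vertex_smul K Y m]
      exact Finset.sum_eq_zero fun s _ => hM s 0 le_rfl m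
    exact .of_subsingleton _
  | succ t ih =>
    refine .extension (Submodule.injective_subtype (arrowSocle K Y M))
      (LinearMap.exact_subtype_mkQ _) (Submodule.mkQ_surjective _)
      (projectiveDimensionLT_of_arrows K Y hd fun s m => Subtype.ext (m.2 s 0)) (ih ?_)
    intro s l hl m
    obtain ⟨m, rfl⟩ := Submodule.mkQ_surjective _ m
    rw [← map_smul, Submodule.mkQ_apply, Submodule.Quotient.mk_eq_zero]
    intro r k
    rw [← mul_smul, ← MulOpposite.op_mul]
    by_cases h : s + l = r
    · subst h
      rw [path_mul_path]
      exact hM s _ (by omega) m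
    · rw [path_mul_path_of_ne K Y h, MulOpposite.op_zero, zero_smul]

/-- The projective dimensions of all right modules are bounded in terms of the projective dimensions
of the radicals of the indecomposable projective modules. -/
theorem projectiveDimensionLT_of_pathIdeal {d : ℕ}
    (hd : ∀ s, ProjectiveDimensionLT Λᵐᵒᵖ (pathIdeal K Y s 1) (d + 1))
    (M : Type u) [AddCommGroup M] [Module Λᵐᵒᵖ M] : ProjectiveDimensionLT Λᵐᵒᵖ M (d + 2) := by
  refine projectiveDimensionLT_of_paths K Y hd (∑ s : ZMod n, Y.loewyLength s) fun s l hl m => ?_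
  rw [path_eq_zero K Y, MulOpposite.op_zero, zero_smul]
  exact (Finset.single_le_sum (f := Y.loewyLength) (fun _ _ => Nat.zero_le _)
    (Finset.mem_univ s)).trans hl

end NakayamaAlgebra

/-! ### Finite global dimension in terms of iterated syzygies -/

namespace NakayamaRelations

variable {n : ℕ} [NeZero n] (Y : NakayamaRelations n)

/-- The source and the length of the path that generates the syzygy of the right ideal generated by
the path with the given source and length. -/
noncomputable def syzygy (p : ZMod n × ℕ) : ZMod n × ℕ := (p.1 + p.2, Y.loewyLength p.1 - p.2)

/-- Guarantees that the natural subtraction in `syzygy` is never truncated along the iteration. -/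
theorem iterate_syzygy_le (s : ZMod n) (k : ℕ) :
    (Y.syzygy^[k] (s, 1)).2 ≤ Y.loewyLength (Y.syzygy^[k] (s, 1)).1 := by
  induction k with
  | zero => exact Y.loewyLength_pos s
  | succ k ih =>
    rw [Function.iterate_succ_apply']
    exact Nat.sub_le_iff_le_add.2 (Y.loewyLength_le_add _ _)

end NakayamaRelations

namespace NakayamaAlgebra

variable (K : Type u) [Field K] {n : ℕ} [NeZero n] (Y : NakayamaRelations n)

theorem projectiveDimensionLT_iterate_syzygy (s : ZMod n) (k d : ℕ) :
    ProjectiveDimensionLT (NakayamaAlgebra K Y)ᵐᵒᵖ (pathIdeal K Y s 1) (d + k + 1) ↔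
      ProjectiveDimensionLT (NakayamaAlgebra K Y)ᵐᵒᵖ
        (pathIdeal K Y (Y.syzygy^[k] (s, 1)).1 (Y.syzygy^[k] (s, 1)).2) (d + 1) := by
  induction k generalizing d with
  | zero => rfl
  | succ k ih =>
    rw [show d + (k + 1) + 1 = d + 1 + k + 1 by ring, ih (d + 1),
      projectiveDimensionLT_pathIdeal_iff K Y (Y.iterate_syzygy_le s k),
      Function.iterate_succ_apply']
    rfl

/-- A bound `d` makes the `d`-th syzygy of each radical projective, which `not_projective_pathIdeal`
forbids while the next two syzygies are generated by paths of positive length. Conversely, a path of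
length zero generates a projective module. -/
theorem hasFiniteGlobalDimension_iff : HasFiniteGlobalDimension (NakayamaAlgebra K Y) ↔
    ∀ s, ∃ k, (Y.syzygy^[k] (s, 1)).2 = 0 := by
  constructor
  · rintro ⟨d, hd⟩ s
    by_contra! hc
    have h := (projectiveDimensionLT_iterate_syzygy K Y s d 0).1
      (ProjectiveDimensionLT.mono (hd (ModuleCat.of _ (pathIdeal K Y s 1))) (by omega))
    rw [zero_add, ProjectiveDimensionLT.one_iff] at h
    have h₁ := hc (d + 1)
    have h₂ := hc (d + 2)
    rw [Function.iterate_succ_apply', Function.iterate_succ_apply'] at h₂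
    rw [Function.iterate_succ_apply'] at h₁
    refine not_projective_pathIdeal K Y ?_ ?_ h
    · exact Nat.lt_of_sub_ne_zero h₁
    · exact Nat.lt_of_sub_ne_zero h₂
  · intro h
    choose k hk using h
    refine ⟨∑ s, k s + 1, fun M => ?_⟩
    refine projectiveDimensionLT_of_pathIdeal K Y (d := ∑ s, k s) (fun s => ?_) M
    refine ProjectiveDimensionLT.mono (d := k s + 1) ?_ (by
      have := Finset.single_le_sum (f := k) (fun _ _ => Nat.zero_le _) (Finset.mem_univ s)
      omega)
    have := projectiveDimensionLT_iterate_syzygy K Y s (k s) 0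
    rw [zero_add] at this
    rw [this, hk, zero_add, ProjectiveDimensionLT.one_iff]
    infer_instance

end NakayamaAlgebra

/-! ### Passage to the universal cover -/

theorem CyclePath.covers_intCast_iff {n : ℕ} (p : CyclePath n) {s : ℤ} (hs : (s : ZMod n) = p.source)
    (v : ℤ) : p.Covers v ↔ ∃ t : ℤ, s + t * n < v ∧ v < s + p.length + t * n := by
  constructor
  · rintro ⟨a, ha, hl⟩
    have hl' : a + 2 ≤ p.length := hl
    have ha' : (v : ZMod n) - 1 = p.source + a := ha
    have h0 : ((v - 1 - s - a : ℤ) : ZMod n) = 0 := by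
      push_cast
      rw [ha', hs]
      ring
    obtain ⟨t, ht⟩ := (ZMod.intCast_zmod_eq_zero_iff_dvd _ n).1 h0
    rw [mul_comm] at ht
    exact ⟨t, by omega, by omega⟩
  · rintro ⟨t, h₁, h₂⟩
    refine ⟨(v - s - t * n - 1).toNat, ?_, ?_⟩
    · have : (((v - s - t * n - 1).toNat : ℕ) : ZMod n) = ((v - s - t * n - 1 : ℤ) : ZMod n) := by
        rw [← Int.cast_natCast, Int.toNat_of_nonneg (by omega)]
      rw [this, ← hs]
      push_cast
      simp
      ring
    · change _ + 2 ≤ p.length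
      omega

/-- A family of arcs that contains an arc of length more than `n` covers the circle. -/
theorem IsForwardLift.arcsCover_of_long {n : ℕ} {f : ℤ → ℤ} (hf : IsForwardLift n f)
    {S : Finset ℤ} {a : ℤ} (ha : a ∈ S) (hlong : a + n < f a) : ArcsCover n f S := by
  intro v
  have hn : (0 : ℤ) < n := by exact_mod_cast hf.pos
  have h₁ : (v - a - 1) / n * n ≤ v - a - 1 := Int.ediv_mul_le _ hn.ne'
  have h₂ : v - a - 1 < ((v - a - 1) / n + 1) * n := Int.lt_ediv_add_one_mul_self _ hn
  exact ⟨a, ha, (v - a - 1) / n, by omega, by linarith⟩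

namespace NakayamaRelations

variable {n : ℕ} [NeZero n] (Y : NakayamaRelations n)

/-- The vertex at which the shortest zero path that starts at a vertex ends, on the universal
cover. -/
noncomputable def zeroEnd (i : ℤ) : ℤ := i + Y.loewyLength (i : ZMod n)

theorem isForwardLift_zeroEnd : IsForwardLift n Y.zeroEnd where
  pos := Nat.pos_of_ne_zero (NeZero.ne n)
  monotone := monotone_int_of_le_succ fun i => by
    have := Y.loewyLength_le_succ i
    simp only [zeroEnd]
    push_cast
    omega
  lt_map i := by
    have := Y.loewyLength_pos i
    simp only [zeroEnd]
    omega
  map_add i := by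
    simp only [zeroEnd]
    push_cast
    rw [ZMod.natCast_self, add_zero]
    ring

theorem syzygy_intCast {a b : ℤ} (hab : a ≤ b) :
    Y.syzygy ((a : ZMod n), (b - a).toNat) = ((b : ZMod n), (Y.zeroEnd a - b).toNat) := by
  ext
  · have : (((b - a).toNat : ℕ) : ZMod n) = ((b - a : ℤ) : ZMod n) := by
      rw [← Int.cast_natCast, Int.toNat_of_nonneg (by omega)]
    simp only [syzygy, this]
    push_cast
    ring
  · simp only [syzygy, zeroEnd]
    omega

theorem iterate_syzygy_intCast (i : ℤ) (k : ℕ) : Y.syzygy^[2 * k] ((i : ZMod n), 1) =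
    (((Y.zeroEnd^[k] i : ℤ) : ZMod n), (Y.zeroEnd^[k] (i + 1) - Y.zeroEnd^[k] i).toNat) := by
  have hf := Y.isForwardLift_zeroEnd
  induction k with
  | zero => simp
  | succ k ih =>
    have h₁ := hf.monotone.iterate k (show i ≤ i + 1 by omega)
    have h₂ := hf.monotone.iterate k (show i + 1 ≤ Y.zeroEnd i from hf.lt_map i)
    rw [← Function.iterate_succ_apply, Function.iterate_succ_apply'] at h₂
    rw [show 2 * (k + 1) = 2 * k + 1 + 1 by ring, Function.iterate_succ_apply',
      Function.iterate_succ_apply', ih, Y.syzygy_intCast h₁, Y.syzygy_intCast h₂,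
      Function.iterate_succ_apply', Function.iterate_succ_apply']

/-- Even syzygies measure the gap from `f^k i` to `f^k (i + 1)`, odd ones the gap from `f^k (i + 1)`
to `f^(k + 1) i`, where `f` is `zeroEnd`. -/
theorem exists_iterate_syzygy_iff : (∀ s, ∃ k, (Y.syzygy^[k] (s, 1)).2 = 0) ↔
    ∀ i : ℤ, ∃ k, Y.zeroEnd^[k] i = Y.zeroEnd^[k] (i + 1) ∨
      Y.zeroEnd^[k] (i + 1) = Y.zeroEnd^[k + 1] i := by
  have hf := Y.isForwardLift_zeroEnd
  have hodd : ∀ (i : ℤ) (k : ℕ), (Y.syzygy^[2 * k + 1] ((i : ZMod n), 1)).2 =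
      (Y.zeroEnd^[k + 1] i - Y.zeroEnd^[k] (i + 1)).toNat := fun i k => by
    rw [Function.iterate_succ_apply', Y.iterate_syzygy_intCast,
      Y.syzygy_intCast (hf.monotone.iterate k (by omega)), Function.iterate_succ_apply']
  constructor
  · intro h i
    have h₁ := fun k => hf.monotone.iterate k (show i ≤ i + 1 by omega)
    have h₂ := fun k => hf.monotone.iterate k (show i + 1 ≤ Y.zeroEnd i from hf.lt_map i)
    obtain ⟨m, hm⟩ := h i
    obtain ⟨k, rfl | rfl⟩ := Nat.even_or_odd' m
    · rw [Y.iterate_syzygy_intCast] at hm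
      have := h₁ k
      exact ⟨k, Or.inl (by simp only at hm; omega)⟩
    · rw [hodd] at hm
      have := h₂ k
      rw [← Function.iterate_succ_apply] at this
      change _ ≤ Y.zeroEnd^[k + 1] i at this
      exact ⟨k, Or.inr (by omega)⟩
  · intro h s
    obtain ⟨i, rfl⟩ := ZMod.intCast_surjective s
    obtain ⟨k, hk | hk⟩ := h i
    · exact ⟨2 * k, by rw [Y.iterate_syzygy_intCast, hk]; simp⟩
    · exact ⟨2 * k + 1, by rw [hodd, hk]; simp⟩

/-! ### Relations as arcs, and the Euler characteristic -/

theorem loewyLength_eq_of_mem {y : CyclePath n} (hy : y ∈ Y.rels) :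
    Y.loewyLength y.source = y.length := by
  refine le_antisymm (Y.isZeroPath_iff.1 ⟨y, hy, 0, by simp, by simp⟩) ?_
  obtain ⟨z, hz, a, ha, hl⟩ := Y.isZeroPath_iff.2 (le_refl (Y.loewyLength y.source))
  have hl' : a + z.length ≤ Y.loewyLength y.source := hl
  have hle : Y.loewyLength y.source ≤ y.length := Y.isZeroPath_iff.1 ⟨y, hy, 0, by simp, by simp⟩
  have := Y.irredundant z hz y hy ⟨a, ha, by omega⟩
  subst this
  omega

/-- The shortest zero path from `s` is a relation exactly when deleting its first arrow makes it
nonzero. In terms of `zeroEnd` this says that `s` is a jump. -/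
theorem mk_loewyLength_mem_iff (s : ZMod n) :
    (⟨s, Y.loewyLength s⟩ : CyclePath n) ∈ Y.rels ↔ Y.loewyLength s ≤ Y.loewyLength (s + 1) := by
  constructor
  · intro h
    by_contra! hc
    obtain ⟨z, hz, a, ha, hl⟩ := Y.isZeroPath_iff.2 (le_refl (Y.loewyLength (s + 1)))
    have ha' : z.source = s + 1 + a := ha
    have hl' : a + z.length ≤ Y.loewyLength (s + 1) := hl
    have := Y.irredundant z hz _ h
      ⟨a + 1, by rw [ha']; push_cast; ring, by change a + 1 + z.length ≤ Y.loewyLength s; omega⟩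
    subst this
    have hl'' : a + Y.loewyLength s ≤ Y.loewyLength (s + 1) := hl
    omega
  · intro h
    obtain ⟨z, hz, a, ha, hl⟩ := Y.isZeroPath_iff.2 (le_refl (Y.loewyLength s))
    have ha' : z.source = s + a := ha
    have hl' : a + z.length ≤ Y.loewyLength s := hl
    rcases Nat.eq_zero_or_pos a with rfl | ha0
    · have hs : z.source = s := by simpa using ha'
      have := Y.loewyLength_eq_of_mem hz
      rw [hs] at this
      have hzs : (⟨s, Y.loewyLength s⟩ : CyclePath n) = z := CyclePath.ext hs.symm this
      exact hzs ▸ hz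
    · have hz' : Y.loewyLength (s + 1) ≤ Y.loewyLength s - 1 := by
        refine Y.isZeroPath_iff.1 ⟨z, hz, a - 1, ?_, ?_⟩
        · change z.source = s + 1 + _
          rw [ha', Nat.cast_sub ha0]
          push_cast
          ring
        · change a - 1 + z.length ≤ Y.loewyLength s - 1
          omega
      have := Y.loewyLength_pos s
      omega

theorem mem_jumps_zeroEnd {a : ℤ} : a ∈ jumps n Y.zeroEnd ↔
    (0 ≤ a ∧ a < n) ∧ (⟨a, Y.loewyLength a⟩ : CyclePath n) ∈ Y.rels := by
  rw [jumps, Finset.mem_filter, Finset.mem_Ico, mk_loewyLength_mem_iff]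
  refine and_congr_right fun _ => ?_
  simp only [zeroEnd]
  push_cast
  omega

/-- The source of a short relation, as an integer in `[0, n)`. -/
def shortSource (y : Y.ShortRelation) : ℤ := y.1.source.val

theorem intCast_shortSource (y : Y.ShortRelation) : (Y.shortSource y : ZMod n) = y.1.source := by
  simp [shortSource]

theorem shortSource_injective : Function.Injective Y.shortSource := by
  intro y z h
  have hs : y.1.source = z.1.source := by
    rw [← Y.intCast_shortSource, h, Y.intCast_shortSource]
  refine Subtype.ext (CyclePath.ext hs ?_)
  rw [← Y.loewyLength_eq_of_mem y.2.1, hs, Y.loewyLength_eq_of_mem z.2.1]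

theorem zeroEnd_shortSource (y : Y.ShortRelation) :
    Y.zeroEnd (Y.shortSource y) = Y.shortSource y + y.1.length := by
  rw [zeroEnd, Y.intCast_shortSource, Y.loewyLength_eq_of_mem y.2.1]

theorem shortSource_mem_jumps (y : Y.ShortRelation) : Y.shortSource y ∈ jumps n Y.zeroEnd := by
  rw [mem_jumps_zeroEnd, Y.intCast_shortSource, Y.loewyLength_eq_of_mem y.2.1]
  refine ⟨⟨Int.natCast_nonneg _, ?_⟩, y.2.1⟩
  rw [shortSource]
  exact_mod_cast ZMod.val_lt y.1.source

theorem exists_shortSource_eq {a : ℤ} (ha : a ∈ jumps n Y.zeroEnd) (hs : Y.zeroEnd a ≤ a + n) :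
    ∃ y, Y.shortSource y = a := by
  obtain ⟨⟨h0, hn⟩, hmem⟩ := Y.mem_jumps_zeroEnd.1 ha
  rw [zeroEnd] at hs
  refine ⟨⟨⟨a, Y.loewyLength a⟩, hmem, by simp only; omega⟩, ?_⟩
  rw [shortSource, ZMod.val_intCast]
  exact Int.emod_eq_of_lt h0 hn

theorem arcsCover_image_shortSource (S : Finset Y.ShortRelation) :
    ArcsCover n Y.zeroEnd (S.map ⟨_, Y.shortSource_injective⟩) ↔
      ∀ i : ZMod n, ∃ y ∈ S, y.1.Covers i := by
  rw [ZMod.intCast_surjective.forall]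
  refine forall_congr' fun v => ?_
  simp only [Finset.mem_map, Function.Embedding.coeFn_mk, exists_exists_and_eq_and]
  refine exists_congr fun y => and_congr_right fun _ => ?_
  rw [CyclePath.covers_intCast_iff _ (Y.intCast_shortSource y), zeroEnd_shortSource]

-- Non-covering families of jumps correspond to non-covering sets of short relations, so
-- `sum_not_arcsCover_jumps` evaluates the alternating sum over the simplices together with the
-- empty set.
open Classical in
theorem eulerCharacteristic_relationComplex : Y.relationComplex.eulerCharacteristic =
    ((Finset.range n).filter fun k : ℕ => orbitEntry Y.zeroEnd n k = k + n).card := by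
  have hf := Y.isForwardLift_zeroEnd
  have h₁ := hf.sum_not_arcsCover_jumps
  set cov : Finset Y.ShortRelation → Prop := fun S => ∀ i : ZMod n, ∃ y ∈ S, y.1.Covers i with hcov
  have h₂ : ∑ S ∈ (jumps n Y.zeroEnd).powerset,
      (if ArcsCover n Y.zeroEnd S then 0 else (-1 : ℤ) ^ S.card) =
      ∑ S : Finset Y.ShortRelation with ¬ cov S, (-1 : ℤ) ^ S.card := by
    rw [Finset.sum_ite, Finset.sum_const_zero, zero_add]
    symm
    refine Finset.sum_bij (fun S _ => S.map ⟨_, Y.shortSource_injective⟩) ?_ ?_ ?_ ?_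
    · intro S hS
      rw [Finset.mem_filter, Y.arcsCover_image_shortSource, Finset.mem_powerset]
      refine ⟨fun a ha => ?_, (Finset.mem_filter.1 hS).2⟩
      obtain ⟨y, -, rfl⟩ := Finset.mem_map.1 ha
      exact Y.shortSource_mem_jumps y
    · exact fun S _ T _ h => Finset.map_injective _ h
    · intro T hT
      rw [Finset.mem_filter, Finset.mem_powerset] at hT
      -- A relation longer than `n` covers everything by itself, so a non-covering family has only
      -- short ones.
      have hT' : ∀ a ∈ T, ∃ y, Y.shortSource y = a := fun a ha =>
        Y.exists_shortSource_eq (hT.1 ha) (not_lt.1 fun hc => hT.2 (hf.arcsCover_of_long ha hc))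
      have hS : (Finset.univ.filter fun y => Y.shortSource y ∈ T).map
          ⟨_, Y.shortSource_injective⟩ = T := by
        ext a
        simp only [Finset.mem_map, Finset.mem_filter, Finset.mem_univ, true_and,
          Function.Embedding.coeFn_mk]
        constructor
        · rintro ⟨y, hy, rfl⟩
          exact hy
        · intro ha
          obtain ⟨y, rfl⟩ := hT' a ha
          exact ⟨y, ha, rfl⟩
      refine ⟨_, ?_, hS⟩
      refine Finset.mem_filter.2 ⟨Finset.mem_univ _, fun hc => hT.2 ?_⟩
      rw [← hS]
      exact (Y.arcsCover_image_shortSource _).2 hc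
    · intro S _
      rw [Finset.card_map]
  have h₃ : (Finset.univ.filter fun S => ¬ cov S) =
      insert ∅ (Finset.univ.filter fun S => S ∈ Y.relationComplex.faces) := by
    ext S
    simp only [Finset.mem_filter, Finset.mem_univ, true_and, Finset.mem_insert]
    change ¬ cov S ↔ S = ∅ ∨ S.Nonempty ∧ ¬ cov S
    rcases S.eq_empty_or_nonempty with rfl | hS
    · simp [hcov]
    · simp [hS, hS.ne_empty]
  have h₄ : (∅ : Finset Y.ShortRelation) ∉
      Finset.univ.filter fun S => S ∈ Y.relationComplex.faces := fun h =>
    Finset.not_nonempty_empty (Finset.mem_filter.1 h).2.1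
  have h₅ : ∑ S : Finset Y.ShortRelation with S ∈ Y.relationComplex.faces, (-1 : ℤ) ^ S.card =
      - Y.relationComplex.eulerCharacteristic := by
    rw [AbstractSimplicialComplex.eulerCharacteristic, ← Finset.sum_neg_distrib]
    refine Finset.sum_congr rfl fun S hS => ?_
    have hpos : 0 < S.card := Finset.card_pos.2 (Finset.mem_filter.1 hS).2.1
    conv_lhs => rw [← Nat.sub_add_cancel hpos]
    rw [Nat.succ_eq_add_one, zero_add, pow_succ]
    ring
  rw [h₂, h₃, Finset.sum_insert h₄, h₅, Finset.card_empty, pow_zero] at h₁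
  linarith

end NakayamaRelations

/-- A Nakayama algebra has finite global dimension if and only if its relation complex has Euler
characteristic one. -/
theorem theoremB (K : Type u) [Field K] (n : ℕ) [NeZero n] (Y : NakayamaRelations n) :
    HasFiniteGlobalDimension (NakayamaAlgebra K Y) ↔
      Y.relationComplex.eulerCharacteristic = 1 := by
  rw [NakayamaAlgebra.hasFiniteGlobalDimension_iff, Y.exists_iterate_syzygy_iff,
    ← Y.isForwardLift_zeroEnd.card_orbitEntry_eq_one_iff, Y.eulerCharacteristic_relationComplex,
    Nat.cast_eq_one]
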